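/- Let $n,m\in\mathbb N$, let $P\in\mathbb R^{n\times n}$ be symmetric positive semidefinite, $q\in\mathbb R^n$, $A\in\mathbb R^{m\times n}$, and let $\mathcal C\subseteq\mathbb R^m$ be a nonempty closed convex set that is the Cartesian product of a convex compact set and a translated closed convex cone (either factor may be absent). Consider the problem $$\text{(P)}\qquad \text{minimize } \tfrac12 x^TPx+q^Tx\quad\text{subject to } Ax=z,\ z\in\mathcal C .$$ A KKT point of (P) is a triple $(\bar x,\bar z,\bar y)$ with $A\bar x=\bar z\in\mathcal C$, $P\bar x+q+A^T\bar y=0$, and $\bar y^T(w-\bar z)\le 0$ for all $w\in\mathcal C$. Write $S_{\mathcal C}(y)=\sup_{z\in\mathcal C}y^Tz\in(-\infty,+\infty]$, let $\mathcal C^\infty$ be the recession cone of $\mathcal C$ and $\Pi_{\mathcal C}$ the Euclidean projection onto $\mathcal C$, and write $u\approx_\varepsilon v$ for $\|u-v\|_2\le\varepsilon$. Problem (P) is primal infeasible if there is no $(x,z)$ with $Ax=z\in\mathcal C$; it is dual infeasible if its Lagrange dual (maximize $-\tfrac12x^TPx-S_{\mathcal C}(y)$ subject to $Px+A^Ty=-q$,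 $S_{\mathcal C}(y)<\infty$) has no feasible point $(x,y)$. Let $\rho>0$, $\sigma>0$, $\alpha\in(0,2)$, let $(\mu^k)_{k\in\mathbb N}$, $(\nu^k)_{k\in\mathbb N}$ be summable nonnegative sequences, and let $(x^0,z^0,y^0)\in\mathbb R^n\times\mathbb R^m\times\mathbb R^m$ be arbitrary. Let $(x^k,z^k,y^k)$ be any sequence satisfying, for all $k\ge 0$ and some $(\tilde x^{k+1},\tilde z^{k+1})$, $$\begin{bmatrix}\tilde x^{k+1}\\ \tilde z^{k+1}\end{bmatrix}\approx_{\mu^k}\begin{bmatrix}P+\sigma I&\rho A^T\\ \rho A&-\rho I\end{bmatrix}^{-1}\left(\begin{bmatrix}\sigma I&\rho A^T\\0&0\end{bmatrix}\begin{bmatrix}x^k\\ z^k-y^k/\rho\end{bmatrix}-\begin{bmatrix}q\\0\end{bmatrix}\right),$$ $$x^{k+1}=\alpha\tilde x^{k+1}+(1-\alpha)x^k,$$ $$z^{k+1}\approx_{\nu^k}\Pi_{\mathcal C}\bigl(\alpha\tilde z^{k+1}+(1-\alpha)z^k+y^k/\rho\bigr),$$ $$y^{k+1}=y^k+\rho\bigl(\alpha\tilde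 z^{k+1}+(1-\alpha)z^k-z^{k+1}\bigr).$$ Then the following hold. 1. If (P) has a KKT point, then $(x^k,z^k,y^k)$ converges to a KKT point $(\bar x,\bar z,\bar y)$ of (P); in particular $(\bar x,\bar z)$ is an optimal solution of (P). 2. In every case (whether or not a KKT point exists) the limits $\delta x=\lim_{k\to\infty}(x^{k+1}-x^k)$ and $\delta y=\lim_{k\to\infty}(y^{k+1}-y^k)$ exist, and - (i) if $\delta y\ne0$, then (P) is primal infeasible and $\delta y$ is a certificate of primal infeasibility: $A^T\delta y=0$ and $S_{\mathcal C}(\delta y)<0$; - (ii) if $\delta x\ne0$, then (P) is dual infeasible and $\delta x$ is a certificate of dual infeasibility: $P\delta x=0$, $A\delta x\in\mathcal C^\infty$ and $q^T\delta x<0$; - (iii) if both $\delta x\ne0$ and $\delta y\ne0$, then (P) is both primal and dual infeasible and $\delta y$, $\delta x$ are certificates of primal and dual infeasibility as in (i) and (ii). -/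

import Mathlib

open scoped Matrix Topology

namespace ApproxADMM

/-- The Euclidean norm of a real vector. -/
noncomputable def l2norm {ι : Type*} [Fintype ι] (v : ι → ℝ) : ℝ :=
  ‖(WithLp.toLp 2 v : EuclideanSpace ℝ ι)‖

/-- The relation `u ≈_ε v`, that is, `‖u - v‖₂ ≤ ε`. -/
def Approx {ι : Type*} [Fintype ι] (ε : ℝ) (u v : ι → ℝ) : Prop :=
  l2norm (u - v) ≤ ε

/-- `p` is the Euclidean projection of `v` onto `C`. -/
def IsProjection {ι : Type*} [Fintype ι] (C : Set (ι → ℝ)) (v p : ι → ℝ) : Prop :=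
  p ∈ C ∧ ∀ w ∈ C, l2norm (v - p) ≤ l2norm (v - w)

/-- The support function `S_C(y) = sup_{z ∈ C} ⟨y, z⟩`, with values in the extended reals. -/
noncomputable def supportFn {ι : Type*} [Fintype ι] (C : Set (ι → ℝ)) (y : ι → ℝ) : EReal :=
  ⨆ z ∈ C, ((y ⬝ᵥ z : ℝ) : EReal)

/-- The recession cone `C^∞` of a convex set `C`. -/
def recessionCone {ι : Type*} (C : Set (ι → ℝ)) : Set (ι → ℝ) :=
  {d | ∀ z ∈ C, ∀ t : ℝ, 0 ≤ t → z + t • d ∈ C}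

/-- `C` is the Cartesian product of a convex compact set `B` (in the coordinates belonging to
`s`) and a translate `K + b` of a closed convex cone `K` (in the remaining coordinates). Either
group of coordinates may be empty. -/
def IsCompactProdCone {ι : Type*} (C : Set (ι → ℝ)) : Prop :=
  ∃ (s : Set ι) (B : Set (↥s → ℝ)) (K : ConvexCone ℝ (↥sᶜ → ℝ)) (b : ↥sᶜ → ℝ),
    Convex ℝ B ∧ IsCompact B ∧ IsClosed (K : Set (↥sᶜ → ℝ)) ∧
      C = {z | (fun i : ↥s => z i) ∈ B ∧ (fun i : ↥sᶜ => z i) - b ∈ K}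

section Problem

variable {n m : ℕ}

/-- `(x, z)` is feasible for: minimize `½ xᵀPx + qᵀx` subject to `Ax = z`, `z ∈ C`. -/
def IsFeasible (A : Matrix (Fin m) (Fin n) ℝ) (C : Set (Fin m → ℝ))
    (x : Fin n → ℝ) (z : Fin m → ℝ) : Prop :=
  A *ᵥ x = z ∧ z ∈ C

/-- The objective `½ xᵀPx + qᵀx`. -/
noncomputable def objective (P : Matrix (Fin n) (Fin n) ℝ) (q x : Fin n → ℝ) : ℝ :=
  (1 / 2 : ℝ) * (x ⬝ᵥ (P *ᵥ x)) + q ⬝ᵥ x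

/-- `(x, z)` is a (global) minimizer of the problem. -/
def IsSolution (P : Matrix (Fin n) (Fin n) ℝ) (q : Fin n → ℝ) (A : Matrix (Fin m) (Fin n) ℝ)
    (C : Set (Fin m → ℝ)) (x : Fin n → ℝ) (z : Fin m → ℝ) : Prop :=
  IsFeasible A C x z ∧ ∀ x' z', IsFeasible A C x' z' → objective P q x ≤ objective P q x'

/-- `(x, z, y)` is a KKT point: `(x, z)` is feasible, `Px + q + Aᵀy = 0`, and the multiplier `y`
of the constraint `Ax = z` lies in the normal cone of `C` at `z`. -/
def IsKKT (P : Matrix (Fin n) (Fin n) ℝ) (q : Fin n → ℝ) (A : Matrix (Fin m) (Fin n) ℝ)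
    (C : Set (Fin m → ℝ)) (x : Fin n → ℝ) (z y : Fin m → ℝ) : Prop :=
  IsFeasible A C x z ∧ P *ᵥ x + q + Aᵀ *ᵥ y = 0 ∧ ∀ w ∈ C, y ⬝ᵥ (w - z) ≤ 0

/-- No point satisfies the constraints. -/
def PrimalInfeasible (A : Matrix (Fin m) (Fin n) ℝ) (C : Set (Fin m → ℝ)) : Prop :=
  ¬ ∃ x z, IsFeasible A C x z

/-- The Lagrange dual is: maximize `-½ xᵀPx - S_C(y)` subject to `Px + Aᵀy = -q` and
`S_C(y) < ∞`. It is infeasible when no pair `(x, y)` satisfies its constraints. -/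
def DualInfeasible (P : Matrix (Fin n) (Fin n) ℝ) (q : Fin n → ℝ) (A : Matrix (Fin m) (Fin n) ℝ)
    (C : Set (Fin m → ℝ)) : Prop :=
  ¬ ∃ (x : Fin n → ℝ) (y : Fin m → ℝ), P *ᵥ x + Aᵀ *ᵥ y = -q ∧ supportFn C y < ⊤

/-- `dy` is a certificate of primal infeasibility. -/
def IsPrimalInfeasCert (A : Matrix (Fin m) (Fin n) ℝ) (C : Set (Fin m → ℝ))
    (dy : Fin m → ℝ) : Prop :=
  Aᵀ *ᵥ dy = 0 ∧ supportFn C dy < 0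

/-- `dx` is a certificate of dual infeasibility. -/
def IsDualInfeasCert (P : Matrix (Fin n) (Fin n) ℝ) (q : Fin n → ℝ)
    (A : Matrix (Fin m) (Fin n) ℝ) (C : Set (Fin m → ℝ)) (dx : Fin n → ℝ) : Prop :=
  P *ᵥ dx = 0 ∧ A *ᵥ dx ∈ recessionCone C ∧ q ⬝ᵥ dx < 0

/-- The matrix of the linear system solved in every iteration. -/
def kktMatrix (P : Matrix (Fin n) (Fin n) ℝ) (A : Matrix (Fin m) (Fin n) ℝ) (ρ σ : ℝ) :
    Matrix (Fin n ⊕ Fin m) (Fin n ⊕ Fin m) ℝ :=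
  Matrix.fromBlocks (P + σ • (1 : Matrix (Fin n) (Fin n) ℝ)) (ρ • Aᵀ)
    (ρ • A) (-(ρ • (1 : Matrix (Fin m) (Fin m) ℝ)))

/-- The right-hand side of the linear system, at the iterate `(x, z, y)`. -/
noncomputable def kktRhs (q : Fin n → ℝ) (A : Matrix (Fin m) (Fin n) ℝ) (ρ σ : ℝ)
    (x : Fin n → ℝ) (z y : Fin m → ℝ) : Fin n ⊕ Fin m → ℝ :=
  (Matrix.fromBlocks (σ • (1 : Matrix (Fin n) (Fin n) ℝ)) (ρ • Aᵀ) 0 0 :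
      Matrix (Fin n ⊕ Fin m) (Fin n ⊕ Fin m) ℝ) *ᵥ Sum.elim x (z - ρ⁻¹ • y) - Sum.elim q 0

/-- One iteration of approximate ADMM, from `(x, z, y)` to `(x', z', y')`, with error `μ` in the
linear solve and error `ν` in the projection. -/
def Step (P : Matrix (Fin n) (Fin n) ℝ) (q : Fin n → ℝ) (A : Matrix (Fin m) (Fin n) ℝ)
    (C : Set (Fin m → ℝ)) (ρ σ α μ ν : ℝ)
    (x : Fin n → ℝ) (z y : Fin m → ℝ) (x' : Fin n → ℝ) (z' y' : Fin m → ℝ) : Prop :=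
  ∃ (xt : Fin n → ℝ) (zt : Fin m → ℝ),
    (∃ w : Fin n ⊕ Fin m → ℝ,
      kktMatrix P A ρ σ *ᵥ w = kktRhs q A ρ σ x z y ∧ Approx μ (Sum.elim xt zt) w) ∧
    x' = α • xt + (1 - α) • x ∧
    (∃ p : Fin m → ℝ,
      IsProjection C (α • zt + (1 - α) • z + ρ⁻¹ • y) p ∧ Approx ν z' p) ∧
    y' = y + ρ • (α • zt + (1 - α) • z - z')

end Problem

end ApproxADMM

/-! Write `v = z + y / ρ`. From the first iterate on, `z` approximates the projection `Π v` of `v`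
onto `C` and `y = ρ (v - z)`, so the algorithm is an iteration on the pair `(x, v)`. Up to
summable errors it reads `s ↦ s - α N s` with `N (x, v) = (x - x̂, Π v - A x̂)`, where `x̂`
minimizes `½ xᵀPx + qᵀx + (σ/2) ‖· - x‖² + (ρ/2) ‖A · - (2 Π v - v)‖²`. Strong monotonicity of the
optimality condition for `x̂` and firm nonexpansiveness of `Π` make `N` firmly nonexpansive for
the norm `√(σ ‖x‖² + ρ ‖v‖²)` (`exists_firmlyNonexpansive_operator`); the embedding `embed` turns
this norm into a Euclidean one.

Two facts about such iterations are needed. If `N` has a zero, then the sequence converges to one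
(`FirmlyNonexpansive.exists_tendsto_of_zero`). Without that assumption `N s_k` still converges, to
the element of minimal norm in the closure of the range of `N`
(`FirmlyNonexpansive.exists_tendsto`): all orbits share their asymptotic displacement, and the
minimal element `u` satisfies the variational inequality `‖u‖² ≤ ⟨N a, u⟩` for all `a`.

A KKT point gives a zero of `N`, hence convergence of `(x, v)`; the residuals `A x - z` and `P x +
q + Aᵀ y` are then seen to vanish in the limit, so the limit is a KKT point
(`InexactOrbit.exists_isKKT_tendsto`).

In general the increments of `x` and `v` converge to some `dx` and `dv`. The residuals are linear
in these increments up to vanishing errors, so they converge; therefore the increments of `z`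
converge to `A dx` and those of `y` to `dy = ρ (dv - A dx)`. Since `z_k / k → A dx` and `y_k / k →
dy`, the direction `A dx` lies in the recession cone of `C` and is orthogonal to `dy`, and the
differenced dual residual gives `P dx + Aᵀ dy = 0`, whence both terms vanish. Pairing the dual
residual with `x_k / k` and using that `y_k` is asymptotically normal to `C` gives, for every `w ∈
C`, `qᵀ dx + ⟨w, dy⟩ ≤ -‖dy‖² / (ρ α) - (σ ‖dx‖² + ρ ‖A dx‖²) / α`. Pairing the dual residual with
`dx` bounds `qᵀ dx` below by the last term, and pairing `A x - z` with `dy` shows that `⟨z_k, dy⟩`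
tends to `-‖dy‖² / (ρ α)`. Together these bound the support function at `dy` and `qᵀ dx` by
negative numbers (`InexactOrbit.certificates`). -/

namespace ApproxADMM

open Filter

/-! ### Inexact iteration of averaged operators -/

section Averaged

variable {H : Type*} [NormedAddCommGroup H] [InnerProductSpace ℝ H]

/-- `N` is firmly nonexpansive (1-cocoercive). For `0 < α < 2` this makes `x ↦ x - α N x` averaged;
the fixed points of that map are the zeros of `N`. -/
def FirmlyNonexpansive (N : H → H) : Prop :=
  ∀ a b, ‖N a - N b‖ ^ 2 ≤ inner ℝ (N a - N b) (a - b)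

theorem FirmlyNonexpansive.norm_relaxed_sub_sq_le {N : H → H} (hN : FirmlyNonexpansive N)
    {α : ℝ} (hα : 0 ≤ α) (a b : H) :
    ‖(a - α • N a) - (b - α • N b)‖ ^ 2 + α * (2 - α) * ‖N a - N b‖ ^ 2 ≤ ‖a - b‖ ^ 2 := by
  have h : (a - α • N a) - (b - α • N b) = (a - b) - α • (N a - N b) := by module
  rw [h, norm_sub_sq_real, norm_smul, mul_pow, real_inner_smul_right, Real.norm_eq_abs, sq_abs,
    real_inner_comm]
  nlinarith [mul_le_mul_of_nonneg_left (hN a b) hα]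

theorem FirmlyNonexpansive.norm_relaxed_sub_le {N : H → H} (hN : FirmlyNonexpansive N)
    {α : ℝ} (hα : α ∈ Set.Icc (0 : ℝ) 2) (a b : H) :
    ‖(a - α • N a) - (b - α • N b)‖ ≤ ‖a - b‖ := by
  have h := hN.norm_relaxed_sub_sq_le hα.1 a b
  have h2 : 0 ≤ α * (2 - α) * ‖N a - N b‖ ^ 2 :=
    mul_nonneg (mul_nonneg hα.1 (by linarith [hα.2])) (sq_nonneg _)
  exact abs_le_of_sq_le_sq' (by linarith) (norm_nonneg _) |>.2

theorem FirmlyNonexpansive.norm_sub_le {N : H → H} (hN : FirmlyNonexpansive N) (a b : H) :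
    ‖N a - N b‖ ≤ ‖a - b‖ := by
  have h := (hN a b).trans (real_inner_le_norm _ _)
  by_contra! hlt
  nlinarith [norm_nonneg (N a - N b), norm_nonneg (a - b)]

theorem FirmlyNonexpansive.continuous {N : H → H} (hN : FirmlyNonexpansive N) :
    Continuous N :=
  (LipschitzWith.of_dist_le_mul (K := 1) fun a b => by
    simpa [dist_eq_norm] using hN.norm_sub_le a b).continuous

theorem le_add_sum_of_le_add {a ε : ℕ → ℝ} (h : ∀ k, a (k + 1) ≤ a k + ε k) (N j : ℕ) :
    a (N + j) ≤ a N + ∑ i ∈ Finset.range j, ε (N + i) := by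
  induction j with
  | zero => simp
  | succ j ih =>
    rw [Finset.sum_range_succ, ← add_assoc]
    linarith [h (N + j), add_assoc N j 1]

variable {N : H → H} {α : ℝ} {s e : ℕ → H}

/-- The displacements along an inexact and an exact orbit become equal in the limit: the squared
distance of the orbits drops in each step by a multiple of the squared difference of the
displacements, up to a summable error. -/
theorem FirmlyNonexpansive.tendsto_sub_orbit (hN : FirmlyNonexpansive N)
    (hα : α ∈ Set.Ioo (0 : ℝ) 2) (hs : ∀ k, s (k + 1) = s k - α • N (s k) + e k)
    (he : Summable fun k => ‖e k‖) {r : ℕ → H} (hr : ∀ k, r (k + 1) = r k - α • N (r k)) :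
    Tendsto (fun k => N (s k) - N (r k)) atTop (𝓝 0) := by
  obtain ⟨h0, h2⟩ := hα
  have hc : 0 < α * (2 - α) := mul_pos h0 (by linarith)
  set a : ℕ → ℝ := fun k => ‖s k - r k‖ with ha
  set g : ℕ → ℝ := fun k => ‖(s k - α • N (s k)) - (r k - α • N (r k))‖ with hg
  have hga : ∀ k, g k ≤ a k := fun k => hN.norm_relaxed_sub_le ⟨h0.le, h2.le⟩ _ _
  have hag : ∀ k, a (k + 1) ≤ g k + ‖e k‖ := by
    intro k
    simp only [ha, hg, hs k, hr k]
    refine le_trans (le_of_eq ?_) (norm_add_le _ _)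
    congr 1; abel
  have hsum : ∀ k, ∑ i ∈ Finset.range k, ‖e i‖ ≤ ∑' i, ‖e i‖ :=
    fun k => he.sum_le_tsum _ fun i _ => norm_nonneg _
  set B : ℝ := a 0 + ∑' i, ‖e i‖ with hB
  have haB : ∀ k, a k ≤ B := by
    intro k
    have := le_add_sum_of_le_add (a := a) (ε := fun k => ‖e k‖)
      (fun k => (hag k).trans (by linarith [hga k])) 0 k
    simp only [zero_add] at this
    linarith [hsum k]
  have hB0 : 0 ≤ B := (norm_nonneg _).trans (haB 0)
  have hstep : ∀ k, α * (2 - α) * ‖N (s k) - N (r k)‖ ^ 2 ≤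
      2 * B * (a k - a (k + 1) + ‖e k‖) := by
    intro k
    have h1 := hN.norm_relaxed_sub_sq_le h0.le (s k) (r k)
    change g k ^ 2 + _ ≤ a k ^ 2 at h1
    have h3 : (a k - g k) * (a k + g k) ≤ (a k - g k) * (2 * B) :=
      mul_le_mul_of_nonneg_left (by linarith [hga k, haB k]) (by linarith [hga k])
    have h4 : (a k - g k) * (2 * B) ≤ (a k - a (k + 1) + ‖e k‖) * (2 * B) :=
      mul_le_mul_of_nonneg_right (by linarith [hag k]) (by linarith)
    nlinarith
  have hsummable : Summable fun k => α * (2 - α) * ‖N (s k) - N (r k)‖ ^ 2 := by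
    refine summable_of_sum_range_le (c := 2 * B * B) (fun k => by positivity) fun n => ?_
    refine (Finset.sum_le_sum fun k _ => hstep k).trans ?_
    rw [← Finset.mul_sum, Finset.sum_add_distrib, Finset.sum_range_sub']
    have := hsum n
    have : 0 ≤ a n := norm_nonneg _
    exact mul_le_mul_of_nonneg_left (by linarith) (by linarith)
  have ht := hsummable.tendsto_atTop_zero.const_mul (α * (2 - α))⁻¹
  simp only [mul_zero, inv_mul_cancel_left₀ hc.ne'] at ht
  rw [tendsto_zero_iff_norm_tendsto_zero]
  simpa [Real.sqrt_sq] using ht.sqrt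

section Proper

variable [ProperSpace H]

/-- The element of minimal norm in the closure of the range of `N`, obtained as a limit of
`N xₜ` where `xₜ` is the fixed point of the contraction `(1 - t) (I - N)`. Monotonicity of `N`
turns into the variational inequality in the limit `t → 0`. -/
theorem FirmlyNonexpansive.exists_minimal (hN : FirmlyNonexpansive N) :
    ∃ u, u ∈ closure (Set.range N) ∧ ∀ a, ‖u‖ ^ 2 ≤ inner ℝ (N a) u := by
  have hfix : ∀ j : ℕ, ∃ x : H, N x = -((1 : ℝ) / (j + 1)) • x := by
    intro j
    -- `c = 1 - t` with `t = 1 / (j + 2)`, so that `t / (1 - t) = 1 / (j + 1)`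
    set c : NNReal := (j + 1) / (j + 2) with hc
    have hc1 : c < 1 := by
      rw [hc, div_lt_one (by positivity)]
      simp
    have hcontr : ContractingWith c (fun x => (c : ℝ) • (x - N x)) := by
      refine ⟨hc1, LipschitzWith.of_dist_le_mul fun a b => ?_⟩
      rw [dist_eq_norm, dist_eq_norm, ← smul_sub, norm_smul, Real.norm_eq_abs, NNReal.abs_eq]
      refine mul_le_mul_of_nonneg_left ?_ c.2
      simpa using hN.norm_relaxed_sub_le (α := 1) (by norm_num) a b
    refine ⟨hcontr.fixedPoint, ?_⟩
    have h := hcontr.fixedPoint_isFixedPt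
    set x := hcontr.fixedPoint
    change (c : ℝ) • (x - N x) = x at h
    have hcv : (c : ℝ) = (j + 1) / (j + 2) := by simp [hc]
    have hj : (j : ℝ) + 1 ≠ 0 := by positivity
    have hj2 : (j : ℝ) + 2 ≠ 0 := by positivity
    have h' : N x = x - (c : ℝ)⁻¹ • x := by
      nth_rewrite 3 [← h]
      rw [smul_smul, inv_mul_cancel₀ (by rw [hcv]; positivity), one_smul]
      abel
    rw [h']
    nth_rewrite 1 [← one_smul ℝ x]
    rw [← sub_smul, hcv]
    congr 1
    field_simp
    ring
  choose x hx using hfix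
  have hmono : ∀ j a, ‖N (x j)‖ ^ 2 ≤
      inner ℝ (N a) (N (x j)) - (1 / (j + 1) : ℝ) * inner ℝ (N (x j) - N a) a := by
    intro j a
    have h := (sq_nonneg _).trans (hN (x j) a)
    have hl : (0 : ℝ) ≤ 1 / (j + 1) := by positivity
    have h2 := mul_nonneg hl h
    rw [← real_inner_smul_right, smul_sub, ← neg_neg ((1 / (j + 1) : ℝ) • x j), ← neg_smul,
      ← hx, inner_sub_right, inner_neg_right, inner_sub_left, real_inner_self_eq_norm_sq,
      real_inner_smul_right] at h2
    linarith
  have hbdd : ∀ j, N (x j) ∈ Metric.closedBall (0 : H) ‖N 0‖ := by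
    intro j
    have h := hmono j 0
    rw [inner_zero_right, mul_zero, sub_zero] at h
    have h' := h.trans (real_inner_le_norm _ _)
    rw [mem_closedBall_zero_iff]
    by_contra! hlt
    nlinarith [norm_nonneg (N (x j)), norm_nonneg (N 0)]
  obtain ⟨u, -, φ, hφ, hu⟩ := tendsto_subseq_of_bounded Metric.isBounded_closedBall hbdd
  refine ⟨u, mem_closure_of_tendsto hu (Eventually.of_forall fun j => ⟨_, rfl⟩), fun a => ?_⟩
  have hlim : Tendsto (fun j => (1 / ((φ j : ℕ) + 1) : ℝ)) atTop (𝓝 0) :=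
    tendsto_one_div_add_atTop_nhds_zero_nat.comp hφ.tendsto_atTop
  have hR : Tendsto (fun j => inner ℝ (N a) (N (x (φ j))) -
      (1 / ((φ j : ℕ) + 1) : ℝ) * inner ℝ (N (x (φ j)) - N a) a) atTop
      (𝓝 (inner ℝ (N a) u - 0 * inner ℝ (u - N a) a)) :=
    (tendsto_const_nhds.inner hu).sub
      (hlim.mul ((hu.sub tendsto_const_nhds).inner tendsto_const_nhds))
  rw [zero_mul, sub_zero] at hR
  exact le_of_tendsto_of_tendsto' (hu.norm.pow 2) hR fun j => hmono (φ j) a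

/-- The displacements of an inexact orbit of an averaged operator converge, whether or not the
operator has a fixed point. The limit is the minimal displacement vector: all orbits share their
asymptotic displacement, whose norm is therefore at most the infimum over all starting points. -/
theorem FirmlyNonexpansive.exists_tendsto (hN : FirmlyNonexpansive N)
    (hα : α ∈ Set.Ioo (0 : ℝ) 2) (hs : ∀ k, s (k + 1) = s k - α • N (s k) + e k)
    (he : Summable fun k => ‖e k‖) :
    ∃ u, Tendsto (fun k => N (s k)) atTop (𝓝 u) := by
  obtain ⟨u, hu, hmin⟩ := hN.exists_minimal
  refine ⟨u, ?_⟩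
  have hnorm : Tendsto (fun k => ‖N (s k)‖) atTop (𝓝 ‖u‖) := by
    refine tendsto_order.2 ⟨fun b hb => Eventually.of_forall fun k => hb.trans_le ?_,
      fun b hb => ?_⟩
    · have h := (hmin (s k)).trans (real_inner_le_norm _ _)
      by_contra! hlt
      nlinarith [norm_nonneg (N (s k)), norm_nonneg u]
    · obtain ⟨_, ⟨a, rfl⟩, ha⟩ := Metric.mem_closure_iff.1 hu ((b - ‖u‖) / 2) (by linarith)
      set r : ℕ → H := fun k => (fun x => x - α • N x)^[k] a with hr
      have hr1 : ∀ k, r (k + 1) = r k - α • N (r k) := fun k =>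
        Function.iterate_succ_apply' _ _ _
      have hra : ∀ k, ‖N (r k)‖ ≤ ‖N a‖ := by
        intro k
        induction k with
        | zero => simp [hr]
        | succ k ih =>
          refine le_trans ?_ ih
          have h := hN.norm_relaxed_sub_le (α := α) ⟨hα.1.le, hα.2.le⟩ (r (k + 1)) (r k)
          have h1 : (r (k + 1) - α • N (r (k + 1))) - (r k - α • N (r k)) =
              -(α • N (r (k + 1))) := by rw [← hr1 k]; abel
          have h2 : r (k + 1) - r k = -(α • N (r k)) := by rw [hr1 k]; abel
          rw [h1, h2, norm_neg, norm_neg, norm_smul, norm_smul] at h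
          exact le_of_mul_le_mul_left h (norm_pos_iff.2 hα.1.ne')
      have hlim := (hN.tendsto_sub_orbit hα hs he hr1).norm
      rw [norm_zero] at hlim
      filter_upwards [hlim.eventually_lt_const (show (0 : ℝ) < (b - ‖u‖) / 2 by linarith)]
        with k hk
      have h1 : ‖N (s k)‖ ≤ ‖N (s k) - N (r k)‖ + ‖N (r k)‖ := by
        simpa using norm_add_le (N (s k) - N (r k)) (N (r k))
      have h2 : ‖N a‖ ≤ ‖u‖ + dist u (N a) := by
        rw [dist_eq_norm]
        simpa using _root_.norm_sub_le u (u - N a)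
      linarith [hra k]
  rw [tendsto_iff_norm_sub_tendsto_zero]
  have hsq : Tendsto (fun k => ‖N (s k)‖ ^ 2 - ‖u‖ ^ 2) atTop (𝓝 0) := by
    rw [← sub_self (‖u‖ ^ 2)]
    exact (hnorm.pow 2).sub_const _
  have hsq' : Tendsto (fun k => ‖N (s k) - u‖ ^ 2) atTop (𝓝 0) := by
    refine squeeze_zero (fun k => sq_nonneg _) (fun k => ?_) hsq
    rw [norm_sub_sq_real]
    linarith [hmin (s k)]
  simpa [Real.sqrt_sq] using hsq'.sqrt

/-- Inexact Krasnoselskii–Mann iteration: if the operator has a fixed point, then the orbit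
converges to one. -/
theorem FirmlyNonexpansive.exists_tendsto_of_zero (hN : FirmlyNonexpansive N)
    (hα : α ∈ Set.Ioo (0 : ℝ) 2) (hs : ∀ k, s (k + 1) = s k - α • N (s k) + e k)
    (he : Summable fun k => ‖e k‖) {a : H} (ha : N a = 0) :
    ∃ l, N l = 0 ∧ Tendsto s atTop (𝓝 l) := by
  have hstep : ∀ b, N b = 0 → ∀ k, ‖s (k + 1) - b‖ ≤ ‖s k - b‖ + ‖e k‖ := by
    intro b hb k
    have h := hN.norm_relaxed_sub_le (α := α) ⟨hα.1.le, hα.2.le⟩ (s k) b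
    rw [hb, smul_zero, sub_zero] at h
    calc ‖s (k + 1) - b‖ = ‖(s k - α • N (s k) - b) + e k‖ := by rw [hs k]; congr 1; abel
      _ ≤ _ := (norm_add_le _ _).trans (by linarith)
  have hbdd : ∀ k, s k ∈ Metric.closedBall a (‖s 0 - a‖ + ∑' i, ‖e i‖) := by
    intro k
    rw [mem_closedBall_iff_norm]
    have h := le_add_sum_of_le_add (a := fun k => ‖s k - a‖) (hstep a ha) 0 k
    simp only [zero_add] at h
    exact h.trans (by gcongr; exact he.sum_le_tsum _ fun i _ => norm_nonneg _)
  obtain ⟨l, -, φ, hφ, hl⟩ := tendsto_subseq_of_bounded Metric.isBounded_closedBall hbdd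
  have h0 : Tendsto (fun k => N (s k)) atTop (𝓝 0) := by
    simpa [ha] using hN.tendsto_sub_orbit hα hs he (r := fun _ => a) (by simp [ha])
  have hNl : N l = 0 := tendsto_nhds_unique ((hN.continuous.tendsto l).comp hl)
    (h0.comp hφ.tendsto_atTop)
  refine ⟨l, hNl, Metric.tendsto_atTop.2 fun δ hδ => ?_⟩
  have htail := (tendsto_sum_nat_add fun k => ‖e k‖).comp hφ.tendsto_atTop
  have hl' := (tendsto_iff_norm_sub_tendsto_zero.1 hl).add htail
  rw [add_zero] at hl'
  obtain ⟨j, hj⟩ := (hl'.eventually_lt_const hδ).exists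
  refine ⟨φ j, fun k hk => ?_⟩
  obtain ⟨i, rfl⟩ := Nat.exists_eq_add_of_le hk
  rw [dist_eq_norm]
  refine lt_of_le_of_lt ((le_add_sum_of_le_add (a := fun k => ‖s k - l‖)
    (hstep l hNl) (φ j) i).trans ?_) hj
  simp only [Function.comp]
  gcongr
  simp only [add_comm (φ j)]
  exact ((summable_nat_add_iff (φ j)).2 he).sum_le_tsum _ fun i _ => norm_nonneg _

end Proper

end Averaged

/-! ### Weighted Euclidean product space -/

section Embed

variable {ι κ : Type*}

/-- The pair `(a, b)`, scaled so that the Euclidean norm becomes the norm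
`√(σ ‖a‖² + ρ ‖b‖²)` in which the iteration is averaged. -/
noncomputable def embed (σ ρ : ℝ) (a : ι → ℝ) (b : κ → ℝ) : EuclideanSpace ℝ (ι ⊕ κ) :=
  WithLp.toLp 2 (Sum.elim (√σ • a) (√ρ • b))

/-- The first component of a point of the weighted product space. -/
noncomputable def fstPart (σ : ℝ) (h : EuclideanSpace ℝ (ι ⊕ κ)) : ι → ℝ :=
  (√σ)⁻¹ • fun i => h (Sum.inl i)

/-- The second component of a point of the weighted product space. -/
noncomputable def sndPart (ρ : ℝ) (h : EuclideanSpace ℝ (ι ⊕ κ)) : κ → ℝ :=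
  (√ρ)⁻¹ • fun i => h (Sum.inr i)

variable {σ ρ : ℝ}

theorem embed_add (a c : ι → ℝ) (b d : κ → ℝ) :
    embed σ ρ (a + c) (b + d) = embed σ ρ a b + embed σ ρ c d := by
  ext (i | i) <;> simp [embed]

theorem embed_smul (t : ℝ) (a : ι → ℝ) (b : κ → ℝ) :
    embed σ ρ (t • a) (t • b) = t • embed σ ρ a b := by
  ext (i | i) <;> simp [embed] <;> ring

theorem embed_sub (a c : ι → ℝ) (b d : κ → ℝ) :
    embed σ ρ (a - c) (b - d) = embed σ ρ a b - embed σ ρ c d := by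
  ext (i | i) <;> simp [embed, mul_sub]

theorem fstPart_embed (hσ : 0 < σ) (a : ι → ℝ) (b : κ → ℝ) :
    fstPart σ (embed σ ρ a b) = a := by
  ext i
  simp [fstPart, embed, (Real.sqrt_pos.2 hσ).ne']

theorem sndPart_embed (hρ : 0 < ρ) (a : ι → ℝ) (b : κ → ℝ) :
    sndPart ρ (embed σ ρ a b) = b := by
  ext i
  simp [sndPart, embed, (Real.sqrt_pos.2 hρ).ne']

theorem embed_fstPart_sndPart (hσ : 0 < σ) (hρ : 0 < ρ) (h : EuclideanSpace ℝ (ι ⊕ κ)) :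
    embed σ ρ (fstPart σ h) (sndPart ρ h) = h := by
  ext (i | i) <;>
  simp [fstPart, sndPart, embed, (Real.sqrt_pos.2 hρ).ne', (Real.sqrt_pos.2 hσ).ne']

theorem continuous_fstPart : Continuous (fstPart σ : EuclideanSpace ℝ (ι ⊕ κ) → ι → ℝ) := by
  unfold fstPart; fun_prop

theorem continuous_sndPart : Continuous (sndPart ρ : EuclideanSpace ℝ (ι ⊕ κ) → κ → ℝ) := by
  unfold sndPart; fun_prop

variable [Fintype ι] [Fintype κ]

theorem l2norm_sq (v : ι → ℝ) : l2norm v ^ 2 = v ⬝ᵥ v := by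
  rw [l2norm, EuclideanSpace.norm_sq_eq]
  simp [dotProduct, pow_two]

theorem l2norm_nonneg (v : ι → ℝ) : 0 ≤ l2norm v := norm_nonneg _

theorem dotProduct_self_nonneg' (v : ι → ℝ) : 0 ≤ v ⬝ᵥ v := by
  rw [← l2norm_sq]; positivity

theorem dotProduct_self_pos {v : ι → ℝ} (hv : v ≠ 0) : 0 < v ⬝ᵥ v :=
  lt_of_le_of_ne (dotProduct_self_nonneg' v) fun h => hv (dotProduct_self_eq_zero.1 h.symm)

theorem inner_embed (hσ : 0 ≤ σ) (hρ : 0 ≤ ρ) (a c : ι → ℝ) (b d : κ → ℝ) :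
    inner ℝ (embed σ ρ a b) (embed σ ρ c d) = σ * (a ⬝ᵥ c) + ρ * (b ⬝ᵥ d) := by
  rw [embed, embed, EuclideanSpace.inner_toLp_toLp]
  simp only [star_trivial, sumElim_dotProduct_sumElim, smul_dotProduct, dotProduct_smul,
    smul_eq_mul]
  rw [← mul_assoc, ← mul_assoc, Real.mul_self_sqrt hσ, Real.mul_self_sqrt hρ, dotProduct_comm c,
    dotProduct_comm d]

theorem norm_embed_sq (hσ : 0 ≤ σ) (hρ : 0 ≤ ρ) (a : ι → ℝ) (b : κ → ℝ) :
    ‖embed σ ρ a b‖ ^ 2 = σ * (a ⬝ᵥ a) + ρ * (b ⬝ᵥ b) := by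
  rw [← real_inner_self_eq_norm_sq, inner_embed hσ hρ]

theorem norm_embed_le (hσ : 0 ≤ σ) (hρ : 0 ≤ ρ) (a : ι → ℝ) (b : κ → ℝ) :
    ‖embed σ ρ a b‖ ≤ (√σ + √ρ) * l2norm (Sum.elim a b) := by
  refine abs_le_of_sq_le_sq' ?_ (mul_nonneg (by positivity) (l2norm_nonneg _)) |>.2
  rw [norm_embed_sq hσ hρ, mul_pow, l2norm_sq, sumElim_dotProduct_sumElim]
  have h1 := dotProduct_self_nonneg' a
  have h2 := dotProduct_self_nonneg' b
  have h3 : 0 ≤ √σ * √ρ := by positivity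
  have h4 : (√σ + √ρ) ^ 2 = σ + ρ + 2 * (√σ * √ρ) := by
    rw [add_sq, Real.sq_sqrt hσ, Real.sq_sqrt hρ]; ring
  rw [h4]
  nlinarith [mul_nonneg hσ h2, mul_nonneg hρ h1, mul_nonneg h3 h1, mul_nonneg h3 h2]

theorem norm_embed_zero_left (hρ : 0 ≤ ρ) (b : κ → ℝ) :
    ‖embed σ ρ (0 : ι → ℝ) b‖ = √ρ * l2norm b := by
  have : embed σ ρ (0 : ι → ℝ) b = embed 0 ρ (0 : ι → ℝ) b := by simp [embed]
  rw [← sq_eq_sq₀ (norm_nonneg _) (mul_nonneg (Real.sqrt_nonneg _) (l2norm_nonneg _)), this,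
    norm_embed_sq le_rfl hρ, mul_pow, l2norm_sq, Real.sq_sqrt hρ]
  ring

end Embed

/-! ### Projections and the linear system -/

section Projection

variable {κ : Type*} [Fintype κ] {C : Set (κ → ℝ)}

/-- `p` is the point of `C` with `v - p` in the normal cone of `C` at `p`. For convex `C` this is
the Euclidean projection of `v`. -/
def IsNormalProj (C : Set (κ → ℝ)) (v p : κ → ℝ) : Prop :=
  p ∈ C ∧ ∀ w ∈ C, (v - p) ⬝ᵥ (w - p) ≤ 0

theorem IsProjection.isNormalProj (hC : Convex ℝ C) {v p : κ → ℝ} (h : IsProjection C v p) :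
    IsNormalProj C v p := by
  refine ⟨h.1, fun w hw => ?_⟩
  have key : ∀ t : ℝ, 0 < t → t ≤ 1 →
      2 * ((v - p) ⬝ᵥ (w - p)) ≤ t * ((w - p) ⬝ᵥ (w - p)) := by
    intro t ht ht1
    have hmem : p + t • (w - p) ∈ C := hC.add_smul_sub_mem h.1 hw ⟨ht.le, ht1⟩
    have h1 := pow_le_pow_left₀ (l2norm_nonneg _) (h.2 _ hmem) 2
    have h2 : v - (p + t • (w - p)) = (v - p) - t • (w - p) := by abel
    rw [l2norm_sq, l2norm_sq, h2] at h1
    simp only [sub_dotProduct _ (t • (w - p)), dotProduct_sub _ _ (t • (w - p)), smul_dotProduct,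
      dotProduct_smul, smul_eq_mul, dotProduct_comm (w - p) (v - p)] at h1
    refine le_of_mul_le_mul_left ?_ ht
    linarith
  by_contra! hpos
  have hq := dotProduct_self_nonneg' (w - p)
  set a := (v - p) ⬝ᵥ (w - p)
  set b := (w - p) ⬝ᵥ (w - p)
  -- this `t` satisfies `t ≤ 1` and `t * b ≤ a`, which contradicts `2 * a ≤ t * b`
  have h3 := key (min 1 (a / (b + 1))) (by positivity) (min_le_left _ _)
  have h4 : min 1 (a / (b + 1)) * b ≤ a / (b + 1) * (b + 1) :=
    mul_le_mul (min_le_right _ _) (by linarith) hq (by positivity)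
  rw [div_mul_cancel₀ _ (by positivity)] at h4
  linarith

theorem exists_isProjection (hne : C.Nonempty) (hcl : IsClosed C) (v : κ → ℝ) :
    ∃ p, IsProjection C v p := by
  have hcl' : IsClosed ((fun w : EuclideanSpace ℝ κ => w.ofLp) ⁻¹' C) :=
    hcl.preimage (by fun_prop)
  obtain ⟨w, hw⟩ := hne
  obtain ⟨p, hp, hd⟩ := hcl'.exists_infDist_eq_dist ⟨WithLp.toLp 2 w, hw⟩ (WithLp.toLp 2 v)
  refine ⟨p.ofLp, hp, fun w hw => ?_⟩
  have h := Metric.infDist_le_dist_of_mem (x := WithLp.toLp 2 v)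
    (show WithLp.toLp 2 w ∈ (fun w : EuclideanSpace ℝ κ => w.ofLp) ⁻¹' C from hw)
  rw [hd, dist_eq_norm, dist_eq_norm] at h
  exact h

/-- Firm nonexpansiveness of the projection. -/
theorem IsNormalProj.sub_dotProduct_nonneg {v p v' p' : κ → ℝ} (h : IsNormalProj C v p)
    (h' : IsNormalProj C v' p') : 0 ≤ (p - p') ⬝ᵥ ((v - v') - (p - p')) := by
  have h1 := h.2 p' h'.1
  have h2 := h'.2 p h.1
  have h3 : (p - p') ⬝ᵥ ((v - v') - (p - p')) =
      -((v - p) ⬝ᵥ (p' - p)) - (v' - p') ⬝ᵥ (p - p') := by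
    rw [dotProduct_comm, ← neg_sub p p', dotProduct_neg, neg_neg, ← sub_dotProduct]
    congr 1; abel
  linarith

theorem IsNormalProj.unique {v p p' : κ → ℝ} (h : IsNormalProj C v p)
    (h' : IsNormalProj C v p') : p = p' := by
  have h1 := h.sub_dotProduct_nonneg h'
  rw [sub_self, zero_sub, dotProduct_neg] at h1
  have h2 := dotProduct_self_nonneg' (p - p')
  exact sub_eq_zero.1 (dotProduct_self_eq_zero.1 (by linarith))

end Projection

section LinearSystem

variable {n m : ℕ} {P : Matrix (Fin n) (Fin n) ℝ} {q : Fin n → ℝ} {A : Matrix (Fin m) (Fin n) ℝ}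
  {ρ σ : ℝ}

/-- `xh` is the minimizer of `½ xᵀPx + qᵀx + (σ/2) ‖x - x₀‖² + (ρ/2) ‖Ax - r‖²`, expressed by
the vanishing of the gradient (equivalent for positive semidefinite `P`). -/
def IsProxPoint (P : Matrix (Fin n) (Fin n) ℝ) (q : Fin n → ℝ) (A : Matrix (Fin m) (Fin n) ℝ)
    (ρ σ : ℝ) (r : Fin m → ℝ) (x₀ xh : Fin n → ℝ) : Prop :=
  P *ᵥ xh + q + σ • (xh - x₀) + ρ • (Aᵀ *ᵥ (A *ᵥ xh - r)) = 0

theorem transpose_mulVec_dotProduct (A : Matrix (Fin m) (Fin n) ℝ) (u : Fin m → ℝ)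
    (v : Fin n → ℝ) : (Aᵀ *ᵥ u) ⬝ᵥ v = u ⬝ᵥ (A *ᵥ v) := by
  rw [Matrix.mulVec_transpose, Matrix.dotProduct_mulVec]

theorem exists_isProxPoint (hP : P.PosSemidef) (hρ : 0 ≤ ρ) (hσ : 0 < σ) (r : Fin m → ℝ)
    (x₀ : Fin n → ℝ) : ∃ xh, IsProxPoint P q A ρ σ r x₀ xh := by
  set M : Matrix (Fin n) (Fin n) ℝ := P + σ • 1 + ρ • (Aᵀ * A) with hM
  have hMv : ∀ v, M *ᵥ v = P *ᵥ v + σ • v + ρ • (Aᵀ *ᵥ (A *ᵥ v)) := fun v => by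
    simp [hM, Matrix.add_mulVec, Matrix.smul_mulVec, Matrix.mulVec_mulVec]
  have hinj : Function.Injective M.mulVec := by
    refine (injective_iff_map_eq_zero (Matrix.mulVecLin M)).2 fun v hv => ?_
    rw [Matrix.mulVecLin_apply, hMv] at hv
    have h := congrArg (fun u => u ⬝ᵥ v) hv
    simp only [add_dotProduct, smul_dotProduct, transpose_mulVec_dotProduct, smul_eq_mul,
      zero_dotProduct] at h
    have h1 := hP.dotProduct_mulVec_nonneg v
    rw [star_trivial, dotProduct_comm] at h1
    have h2 := mul_nonneg hρ (dotProduct_self_nonneg' (A *ᵥ v))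
    have h3 := dotProduct_self_nonneg' v
    exact dotProduct_self_eq_zero.1 (by nlinarith)
  obtain ⟨xh, hxh⟩ := (LinearMap.injective_iff_surjective (f := M.mulVecLin)).1 hinj
    (σ • x₀ + ρ • (Aᵀ *ᵥ r) - q)
  refine ⟨xh, ?_⟩
  rw [Matrix.mulVecLin_apply, hMv] at hxh
  rw [IsProxPoint, Matrix.mulVec_sub, smul_sub, smul_sub]
  linear_combination (exp := 1) hxh

/-- The difference of the optimality conditions of two proximal points, paired with the difference
of the points. -/
theorem IsProxPoint.energy {r r' : Fin m → ℝ} {x x' xh xh' : Fin n → ℝ}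
    (h : IsProxPoint P q A ρ σ r x xh) (h' : IsProxPoint P q A ρ σ r' x' xh') :
    (xh - xh') ⬝ᵥ (P *ᵥ (xh - xh')) + σ * ((xh - xh') ⬝ᵥ (xh - xh')) +
      ρ * ((A *ᵥ (xh - xh')) ⬝ᵥ (A *ᵥ (xh - xh'))) =
    σ * ((x - x') ⬝ᵥ (xh - xh')) + ρ * ((r - r') ⬝ᵥ (A *ᵥ (xh - xh'))) := by
  have hd : P *ᵥ (xh - xh') + σ • (xh - xh') + ρ • (Aᵀ *ᵥ (A *ᵥ (xh - xh'))) =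
      σ • (x - x') + ρ • (Aᵀ *ᵥ (r - r')) := by
    rw [IsProxPoint] at h h'
    simp only [Matrix.mulVec_sub, smul_sub] at h h' ⊢
    linear_combination (exp := 1) h - h'
  have h2 := congrArg (fun u => u ⬝ᵥ (xh - xh')) hd
  simp only [add_dotProduct, smul_dotProduct, transpose_mulVec_dotProduct, smul_eq_mul] at h2
  rw [dotProduct_comm (xh - xh') (P *ᵥ _)]
  exact h2

theorem IsProxPoint.unique (hP : P.PosSemidef) (hρ : 0 ≤ ρ) (hσ : 0 < σ) {r : Fin m → ℝ}
    {x xh xh' : Fin n → ℝ} (h : IsProxPoint P q A ρ σ r x xh)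
    (h' : IsProxPoint P q A ρ σ r x xh') : xh = xh' := by
  have h1 := h.energy h'
  simp only [sub_self, zero_dotProduct, mul_zero, add_zero] at h1
  have h2 := hP.dotProduct_mulVec_nonneg (xh - xh')
  rw [star_trivial] at h2
  have h3 := mul_nonneg hρ (dotProduct_self_nonneg' (A *ᵥ (xh - xh')))
  have h4 := dotProduct_self_nonneg' (xh - xh')
  exact sub_eq_zero.1 (dotProduct_self_eq_zero.1 (by nlinarith))

/-- The proximal point is nonexpansive in the argument `r`, in the weighted norm. -/
theorem IsProxPoint.norm_embed_sub_le (hP : P.PosSemidef) (hρ : 0 ≤ ρ) (hσ : 0 ≤ σ)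
    {r r' : Fin m → ℝ} {x xh xh' : Fin n → ℝ} (h : IsProxPoint P q A ρ σ r x xh)
    (h' : IsProxPoint P q A ρ σ r' x xh') :
    ‖embed σ ρ (xh - xh') (A *ᵥ (xh - xh'))‖ ≤ ‖embed σ ρ (0 : Fin n → ℝ) (r - r')‖ := by
  have h1 := h.energy h'
  have h2 := hP.dotProduct_mulVec_nonneg (xh - xh')
  rw [star_trivial] at h2
  have h3 := real_inner_le_norm (embed σ ρ (0 : Fin n → ℝ) (r - r'))
    (embed σ ρ (xh - xh') (A *ᵥ (xh - xh')))
  rw [inner_embed hσ hρ] at h3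
  have h4 := norm_embed_sq hσ hρ (xh - xh') (A *ᵥ (xh - xh'))
  simp only [sub_self, zero_dotProduct, mul_zero, zero_add] at h1 h3
  by_contra! hlt
  nlinarith [norm_nonneg (embed σ ρ (0 : Fin n → ℝ) (r - r')),
    norm_nonneg (embed σ ρ (xh - xh') (A *ᵥ (xh - xh')))]

theorem kktMatrix_mulVec_eq_kktRhs (hρ : 0 < ρ) {x : Fin n → ℝ} {z y : Fin m → ℝ}
    {w : Fin n ⊕ Fin m → ℝ} (h : kktMatrix P A ρ σ *ᵥ w = kktRhs q A ρ σ x z y) :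
    w ∘ Sum.inr = A *ᵥ (w ∘ Sum.inl) ∧
      IsProxPoint P q A ρ σ (z - ρ⁻¹ • y) x (w ∘ Sum.inl) := by
  rw [kktMatrix, kktRhs, Matrix.fromBlocks_mulVec, Matrix.fromBlocks_mulVec] at h
  have h1 := congrArg (fun f => f ∘ Sum.inl) h
  have h2 := congrArg (fun f => f ∘ Sum.inr) h
  simp only [Pi.sub_comp, Sum.elim_comp_inl, Sum.elim_comp_inr] at h1 h2
  have h3 : w ∘ Sum.inr = A *ᵥ (w ∘ Sum.inl) := by
    simp only [Matrix.smul_mulVec, Matrix.neg_mulVec, Matrix.one_mulVec, Matrix.zero_mulVec,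
      add_zero, sub_zero] at h2
    have h4 : ρ • (A *ᵥ (w ∘ Sum.inl) - w ∘ Sum.inr) = 0 := by
      rw [smul_sub, sub_eq_add_neg]; exact h2
    exact (sub_eq_zero.1 ((smul_eq_zero.1 h4).resolve_left hρ.ne')).symm
  refine ⟨h3, ?_⟩
  rw [h3] at h1
  simp only [Matrix.add_mulVec, Matrix.smul_mulVec, Matrix.one_mulVec] at h1
  rw [IsProxPoint, Matrix.mulVec_sub _ (A *ᵥ (w ∘ Sum.inl)), smul_sub, smul_sub]
  linear_combination (exp := 1) h1

/-! ### The Douglas–Rachford operator of the problem -/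

/-- The operator that underlies the iteration: one exact step changes the state `(x, v)`, where
`v = z + y / ρ`, by `-α` times its value at `(x, v)`. -/
theorem exists_firmlyNonexpansive_operator {C : Set (Fin m → ℝ)} (hP : P.PosSemidef)
    (hCne : C.Nonempty) (hCcl : IsClosed C) (hCcv : Convex ℝ C) (hρ : 0 < ρ) (hσ : 0 < σ) :
    ∃ N : EuclideanSpace ℝ (Fin n ⊕ Fin m) → EuclideanSpace ℝ (Fin n ⊕ Fin m),
      FirmlyNonexpansive N ∧ ∀ x v p xh, IsNormalProj C v p →
        IsProxPoint P q A ρ σ ((2 : ℝ) • p - v) x xh →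
        N (embed σ ρ x v) = embed σ ρ (x - xh) (p - A *ᵥ xh) := by
  choose p hp using fun v => (exists_isProjection hCne hCcl v)
  replace hp := fun v => (hp v).isNormalProj hCcv
  choose X hX using fun v x => exists_isProxPoint (q := q) (A := A) hP hρ.le hσ
    ((2 : ℝ) • p v - v) x
  refine ⟨fun h => embed σ ρ (fstPart σ h - X (sndPart ρ h) (fstPart σ h))
    (p (sndPart ρ h) - A *ᵥ X (sndPart ρ h) (fstPart σ h)), fun a b => ?_, ?_⟩
  · obtain ⟨x, v, rfl⟩ : ∃ x v, embed σ ρ x v = a := ⟨_, _, embed_fstPart_sndPart hσ hρ a⟩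
    obtain ⟨x', v', rfl⟩ : ∃ x v, embed σ ρ x v = b := ⟨_, _, embed_fstPart_sndPart hσ hρ b⟩
    simp only [fstPart_embed hσ, sndPart_embed hρ]
    have h1 := (hX v x).energy (hX v' x')
    have h2 := (hp v).sub_dotProduct_nonneg (hp v')
    have h3 := hP.dotProduct_mulVec_nonneg (X v x - X v' x')
    rw [star_trivial] at h3
    rw [← embed_sub, ← embed_sub, norm_embed_sq hσ.le hρ.le, inner_embed hσ.le hρ.le]
    rw [show x - X v x - (x' - X v' x') = (x - x') - (X v x - X v' x') by abel,
      show p v - A *ᵥ X v x - (p v' - A *ᵥ X v' x') =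
        (p v - p v') - A *ᵥ (X v x - X v' x') by rw [Matrix.mulVec_sub]; abel]
    rw [show (2 : ℝ) • p v - v - ((2 : ℝ) • p v' - v') = (2 : ℝ) • (p v - p v') - (v - v') by
      module] at h1
    generalize X v x - X v' x' = D at *
    generalize A *ᵥ D = AD at *
    generalize p v - p v' = dp at *
    generalize v - v' = dv at *
    generalize x - x' = dx at *
    simp only [sub_dotProduct, dotProduct_sub, smul_dotProduct, smul_eq_mul] at h1 h2 ⊢
    rw [dotProduct_comm D dx, dotProduct_comm AD dp, dotProduct_comm AD dv]
    nlinarith [mul_nonneg hρ.le h2]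
  · intro x v p' xh hp' hxh
    obtain rfl := hp'.unique (hp v)
    simp only [fstPart_embed hσ, sndPart_embed hρ]
    rw [hxh.unique hP hρ.le hσ (hX v x)]

end LinearSystem

/-! ### Inexact orbits -/

section Orbit

variable {n m : ℕ} {P : Matrix (Fin n) (Fin n) ℝ} {q : Fin n → ℝ} {A : Matrix (Fin m) (Fin n) ℝ}
  {C : Set (Fin m → ℝ)} {ρ σ α : ℝ}

/-- The approximate iteration in the state variables `(x, v)` with `v = z + y / ρ`: `p` is the
exact projection of `v`, which `z` approximates, `xh` is the exact solution of the linear system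
at `(x, z, y)`, and `e₁`, `e₂` are the errors made in the update of `x` and `v`. -/
structure InexactOrbit (P : Matrix (Fin n) (Fin n) ℝ) (q : Fin n → ℝ)
    (A : Matrix (Fin m) (Fin n) ℝ) (C : Set (Fin m → ℝ)) (ρ σ α : ℝ)
    (x : ℕ → Fin n → ℝ) (z y p : ℕ → Fin m → ℝ) (xh e₁ : ℕ → Fin n → ℝ)
    (e₂ : ℕ → Fin m → ℝ) : Prop where
  prox : ∀ k, IsProxPoint P q A ρ σ (z k - ρ⁻¹ • y k) (x k) (xh k)
  step_fst : ∀ k, x (k + 1) = x k + α • (xh k - x k) + e₁ k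
  step_snd : ∀ k, z (k + 1) + ρ⁻¹ • y (k + 1) =
    z k + ρ⁻¹ • y k + α • (A *ᵥ xh k - z k) + e₂ k
  proj : ∀ k, IsNormalProj C (z k + ρ⁻¹ • y k) (p k)
  summable_step : Summable fun k => ‖embed σ ρ (e₁ k) (e₂ k)‖
  summable_proj : Summable fun k => ‖embed σ ρ (0 : Fin n → ℝ) (z k - p k)‖

/-- Dropping the initial point, at which `z` need not be close to the projection of `v`, turns
the iteration into an inexact orbit. -/
theorem exists_inexactOrbit (hCcv : Convex ℝ C) (hρ : 0 < ρ) (hσ : 0 < σ) (hα : 0 < α)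
    {μ ν : ℕ → ℝ} (hμ : Summable μ) (hν : Summable ν) {x : ℕ → Fin n → ℝ}
    {z y : ℕ → Fin m → ℝ}
    (hstep : ∀ k : ℕ, Step P q A C ρ σ α (μ k) (ν k)
      (x k) (z k) (y k) (x (k + 1)) (z (k + 1)) (y (k + 1))) :
    ∃ p xh e₁ e₂, InexactOrbit P q A C ρ σ α (fun k => x (k + 1)) (fun k => z (k + 1))
      (fun k => y (k + 1)) p xh e₁ e₂ := by
  choose xt zt hlin hx hproj hy using hstep
  choose w hw hwμ using hlin
  choose p hp hpν using hproj
  have hv : ∀ k, z (k + 1) + ρ⁻¹ • y (k + 1) =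
      α • zt k + (1 - α) • z k + ρ⁻¹ • y k := by
    intro k
    rw [hy k, smul_add, smul_smul, inv_mul_cancel₀ hρ.ne', one_smul]
    abel
  refine ⟨p, fun k => w (k + 1) ∘ Sum.inl, fun k => α • (xt (k + 1) - w (k + 1) ∘ Sum.inl),
    fun k => α • (zt (k + 1) - w (k + 1) ∘ Sum.inr), ?_⟩
  have hker := fun k => kktMatrix_mulVec_eq_kktRhs hρ (hw k)
  refine ⟨fun k => (hker (k + 1)).2, fun k => ?_, fun k => ?_, fun k => ?_, ?_, ?_⟩
  · rw [hx (k + 1)]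
    module
  · rw [hv (k + 1), ← (hker (k + 1)).1]
    module
  · rw [hv k]
    exact (hp k).isNormalProj hCcv
  · refine Summable.of_nonneg_of_le (fun k => norm_nonneg _) (fun k => ?_)
      (((summable_nat_add_iff 1).2 hμ).mul_left (α * (√σ + √ρ)))
    rw [embed_smul, norm_smul, Real.norm_of_nonneg hα.le, mul_assoc]
    refine mul_le_mul_of_nonneg_left ((norm_embed_le hσ.le hρ.le _ _).trans ?_) hα.le
    refine mul_le_mul_of_nonneg_left (le_trans (le_of_eq ?_) (hwμ (k + 1))) (by positivity)
    congr 1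
    ext (i | i) <;> simp
  · refine Summable.of_nonneg_of_le (fun k => norm_nonneg _) (fun k => ?_) (hν.mul_left √ρ)
    rw [norm_embed_zero_left hρ.le]
    exact mul_le_mul_of_nonneg_left (hpν k) (Real.sqrt_nonneg _)

variable {x xh e₁ : ℕ → Fin n → ℝ} {z y p e₂ : ℕ → Fin m → ℝ}

/-- An inexact orbit follows the exact iteration of the operator up to summable errors. Replacing
`z` by the projection `p` perturbs the solution of the linear system by at most twice the
projection error. -/
theorem InexactOrbit.exists_recursion (h : InexactOrbit P q A C ρ σ α x z y p xh e₁ e₂)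
    (hP : P.PosSemidef) (hρ : 0 < ρ) (hσ : 0 < σ) (hα : 0 < α)
    {N : EuclideanSpace ℝ (Fin n ⊕ Fin m) → EuclideanSpace ℝ (Fin n ⊕ Fin m)}
    (hN : ∀ x v p xh, IsNormalProj C v p → IsProxPoint P q A ρ σ ((2 : ℝ) • p - v) x xh →
        N (embed σ ρ x v) = embed σ ρ (x - xh) (p - A *ᵥ xh)) :
    ∃ e : ℕ → EuclideanSpace ℝ (Fin n ⊕ Fin m), (Summable fun k => ‖e k‖) ∧ ∀ k,
      embed σ ρ (x (k + 1)) (z (k + 1) + ρ⁻¹ • y (k + 1)) =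
        embed σ ρ (x k) (z k + ρ⁻¹ • y k) - α • N (embed σ ρ (x k) (z k + ρ⁻¹ • y k)) + e k := by
  choose X hX using fun k => exists_isProxPoint (q := q) (A := A) hP hρ.le hσ
    ((2 : ℝ) • p k - (z k + ρ⁻¹ • y k)) (x k)
  have hbound : ∀ k, ‖embed σ ρ (xh k - X k) (A *ᵥ (xh k - X k))‖ ≤
      2 * ‖embed σ ρ (0 : Fin n → ℝ) (z k - p k)‖ := by
    intro k
    have h1 := (h.prox k).norm_embed_sub_le hP hρ.le hσ.le (hX k)
    have h2 : z k - ρ⁻¹ • y k - ((2 : ℝ) • p k - (z k + ρ⁻¹ • y k)) =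
        (2 : ℝ) • (z k - p k) := by module
    rw [h2, ← smul_zero (2 : ℝ), embed_smul, norm_smul] at h1
    simpa using h1
  refine ⟨fun k => embed σ ρ (e₁ k) (e₂ k) + α • (embed σ ρ (xh k - X k) (A *ᵥ (xh k - X k)) -
    embed σ ρ 0 (z k - p k)), ?_, fun k => ?_⟩
  · refine Summable.of_nonneg_of_le (fun k => norm_nonneg _) (fun k => ?_)
      (h.summable_step.add (h.summable_proj.mul_left (α * 3)))
    refine (norm_add_le _ _).trans (add_le_add le_rfl ?_)
    rw [norm_smul, Real.norm_of_nonneg hα.le, mul_assoc]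
    refine mul_le_mul_of_nonneg_left ((norm_sub_le _ _).trans ?_) hα.le
    linarith [hbound k]
  · dsimp only
    rw [hN _ _ _ _ (h.proj k) (hX k), h.step_fst, h.step_snd, ← embed_sub, ← embed_smul,
      ← embed_smul, ← embed_sub, ← embed_add, ← embed_add, Matrix.mulVec_sub]
    congr 1 <;> module

/-- The increments of `x` and of `v = z + y / ρ` converge. -/
theorem InexactOrbit.exists_tendsto_increments
    (h : InexactOrbit P q A C ρ σ α x z y p xh e₁ e₂) (hP : P.PosSemidef) (hCne : C.Nonempty)
    (hCcl : IsClosed C) (hCcv : Convex ℝ C) (hρ : 0 < ρ) (hσ : 0 < σ)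
    (hα : α ∈ Set.Ioo (0 : ℝ) 2) :
    ∃ dx dv, Tendsto (fun k => x (k + 1) - x k) atTop (𝓝 dx) ∧
      Tendsto (fun k => (z (k + 1) + ρ⁻¹ • y (k + 1)) - (z k + ρ⁻¹ • y k)) atTop (𝓝 dv) := by
  obtain ⟨N, hN, hspec⟩ :=
    exists_firmlyNonexpansive_operator (q := q) (A := A) hP hCne hCcl hCcv hρ hσ
  obtain ⟨e, he, hs⟩ := h.exists_recursion hP hρ hσ hα.1 hspec
  obtain ⟨u, hu⟩ := hN.exists_tendsto hα
    (s := fun k => embed σ ρ (x k) (z k + ρ⁻¹ • y k)) hs he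
  have hd : Tendsto (fun k => embed σ ρ (x (k + 1) - x k)
      ((z (k + 1) + ρ⁻¹ • y (k + 1)) - (z k + ρ⁻¹ • y k))) atTop (𝓝 (-(α • u) + 0)) := by
    refine ((hu.const_smul α).neg.add
      (tendsto_zero_iff_norm_tendsto_zero.2 he.tendsto_atTop_zero)).congr fun k => ?_
    rw [embed_sub, hs k]
    abel
  refine ⟨_, _, ((continuous_fstPart (σ := σ)).tendsto _ |>.comp hd).congr fun k => ?_,
    ((continuous_sndPart (ρ := ρ)).tendsto _ |>.comp hd).congr fun k => ?_⟩
  · exact fstPart_embed hσ _ _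
  · exact sndPart_embed hρ _ _

/-- If there is a KKT point, then `x` and `v = z + y / ρ` converge: KKT points correspond to
zeros of the operator. -/
theorem InexactOrbit.exists_tendsto (h : InexactOrbit P q A C ρ σ α x z y p xh e₁ e₂)
    (hP : P.PosSemidef) (hCcl : IsClosed C) (hCcv : Convex ℝ C) (hρ : 0 < ρ)
    (hσ : 0 < σ) (hα : α ∈ Set.Ioo (0 : ℝ) 2) {xs : Fin n → ℝ} {zs ys : Fin m → ℝ}
    (hk : IsKKT P q A C xs zs ys) :
    ∃ xl vl, Tendsto x atTop (𝓝 xl) ∧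
      Tendsto (fun k => z k + ρ⁻¹ • y k) atTop (𝓝 vl) := by
  obtain ⟨⟨hA, hzC⟩, hstat, hnormal⟩ := hk
  obtain ⟨N, hN, hspec⟩ :=
    exists_firmlyNonexpansive_operator (q := q) (A := A) hP ⟨zs, hzC⟩ hCcl hCcv hρ hσ
  obtain ⟨e, he, hs⟩ := h.exists_recursion hP hρ hσ hα.1 hspec
  have hzero : N (embed σ ρ xs (zs + ρ⁻¹ • ys)) = 0 := by
    rw [hspec xs (zs + ρ⁻¹ • ys) zs xs ⟨hzC, fun w hw => ?_⟩ ?_, hA, sub_self, sub_self]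
    · ext (i | i) <;> simp [embed]
    · rw [IsProxPoint, hA, show zs - ((2 : ℝ) • zs - (zs + ρ⁻¹ • ys)) = ρ⁻¹ • ys by module,
        sub_self, smul_zero, add_zero, Matrix.mulVec_smul, smul_smul, mul_inv_cancel₀ hρ.ne',
        one_smul, hstat]
    · rw [add_sub_cancel_left, smul_dotProduct]
      exact mul_nonpos_of_nonneg_of_nonpos (by positivity) (hnormal w hw)
  obtain ⟨l, -, hl⟩ := hN.exists_tendsto_of_zero hα
    (s := fun k => embed σ ρ (x k) (z k + ρ⁻¹ • y k)) hs he hzero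
  refine ⟨_, _, ((continuous_fstPart (σ := σ)).tendsto _ |>.comp hl).congr fun k => ?_,
    ((continuous_sndPart (ρ := ρ)).tendsto _ |>.comp hl).congr fun k => ?_⟩
  · exact fstPart_embed hσ _ _
  · exact sndPart_embed hρ _ _

/-! ### Limits of the residuals -/

theorem tendsto_dotProduct {ι κ : Type*} [Fintype κ] {l : Filter ι} {u v : ι → κ → ℝ}
    {a b : κ → ℝ} (hu : Tendsto u l (𝓝 a)) (hv : Tendsto v l (𝓝 b)) :
    Tendsto (fun k => u k ⬝ᵥ v k) l (𝓝 (a ⬝ᵥ b)) :=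
  tendsto_finsetSum _ fun i _ => (tendsto_pi_nhds.1 hu i).mul (tendsto_pi_nhds.1 hv i)

theorem tendsto_mulVec {ι κ κ' : Type*} [Fintype κ] {l : Filter ι} (M : Matrix κ' κ ℝ)
    {u : ι → κ → ℝ} {a : κ → ℝ} (hu : Tendsto u l (𝓝 a)) :
    Tendsto (fun k => M *ᵥ u k) l (𝓝 (M *ᵥ a)) :=
  ((continuous_const.matrix_mulVec continuous_id).tendsto a).comp hu

/-- A sequence with convergent increments grows linearly at the limiting rate. -/
theorem tendsto_inv_smul {E : Type*} [NormedAddCommGroup E] [NormedSpace ℝ E] {u : ℕ → E}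
    {d : E} (hu : Tendsto (fun k => u (k + 1) - u k) atTop (𝓝 d)) :
    Tendsto (fun k : ℕ => (k : ℝ)⁻¹ • u k) atTop (𝓝 d) := by
  have h1 := hu.cesaro_smul
  have h2 := (tendsto_inv_atTop_nhds_zero_nat (𝕜 := ℝ)).smul_const (u 0)
  have h3 := h1.add h2
  rw [zero_smul, add_zero] at h3
  refine h3.congr fun k => ?_
  rw [Finset.sum_range_sub, ← smul_add, sub_add_cancel]

theorem InexactOrbit.tendsto_proj_sub (h : InexactOrbit P q A C ρ σ α x z y p xh e₁ e₂)
    (hρ : 0 < ρ) : Tendsto (fun k => z k - p k) atTop (𝓝 0) := by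
  have h1 := (continuous_sndPart (ι := Fin n) (κ := Fin m) (ρ := ρ)).tendsto 0 |>.comp
    (tendsto_zero_iff_norm_tendsto_zero.2 h.summable_proj.tendsto_atTop_zero)
  have h2 : sndPart ρ (0 : EuclideanSpace ℝ (Fin n ⊕ Fin m)) = 0 := by
    ext i; simp [sndPart]
  rw [h2] at h1
  exact h1.congr fun k => sndPart_embed hρ _ _

variable {dx : Fin n → ℝ} {dv : Fin m → ℝ}

theorem InexactOrbit.tendsto_linear (h : InexactOrbit P q A C ρ σ α x z y p xh e₁ e₂)
    (hρ : 0 < ρ) (hσ : 0 < σ) (hα : 0 < α)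
    (hx : Tendsto (fun k => x (k + 1) - x k) atTop (𝓝 dx))
    (hv : Tendsto (fun k => (z (k + 1) + ρ⁻¹ • y (k + 1)) - (z k + ρ⁻¹ • y k)) atTop (𝓝 dv)) :
    Tendsto (fun k => xh k - x k) atTop (𝓝 (α⁻¹ • dx)) ∧
      Tendsto (fun k => A *ᵥ xh k - z k) atTop (𝓝 (α⁻¹ • dv)) := by
  have h0 := tendsto_zero_iff_norm_tendsto_zero.2 h.summable_step.tendsto_atTop_zero
  have h1 := (continuous_fstPart (σ := σ)).tendsto _ |>.comp h0
  have h2 := (continuous_sndPart (ρ := ρ)).tendsto _ |>.comp h0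
  have e1 : fstPart σ (0 : EuclideanSpace ℝ (Fin n ⊕ Fin m)) = 0 := by
    ext i; simp [fstPart]
  have e2 : sndPart ρ (0 : EuclideanSpace ℝ (Fin n ⊕ Fin m)) = 0 := by
    ext i; simp [sndPart]
  rw [e1] at h1
  rw [e2] at h2
  constructor
  · have h3 := (hx.sub h1).const_smul α⁻¹
    rw [sub_zero] at h3
    refine h3.congr fun k => ?_
    simp only [Function.comp, fstPart_embed hσ]
    rw [h.step_fst k, inv_smul_eq_iff₀ hα.ne']
    abel
  · have h3 := (hv.sub h2).const_smul α⁻¹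
    rw [sub_zero] at h3
    refine h3.congr fun k => ?_
    simp only [Function.comp, sndPart_embed hρ]
    rw [h.step_snd k, inv_smul_eq_iff₀ hα.ne']
    abel

theorem InexactOrbit.tendsto_primal_residual
    (h : InexactOrbit P q A C ρ σ α x z y p xh e₁ e₂) (hρ : 0 < ρ) (hσ : 0 < σ) (hα : 0 < α)
    (hx : Tendsto (fun k => x (k + 1) - x k) atTop (𝓝 dx))
    (hv : Tendsto (fun k => (z (k + 1) + ρ⁻¹ • y (k + 1)) - (z k + ρ⁻¹ • y k)) atTop (𝓝 dv)) :
    Tendsto (fun k => A *ᵥ x k - z k) atTop (𝓝 (α⁻¹ • (dv - A *ᵥ dx))) := by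
  obtain ⟨h1, h2⟩ := h.tendsto_linear hρ hσ hα hx hv
  have h3 := h2.sub (tendsto_mulVec A h1)
  rw [Matrix.mulVec_smul, ← smul_sub] at h3
  refine h3.congr fun k => ?_
  rw [Matrix.mulVec_sub]
  abel

theorem InexactOrbit.tendsto_dual_residual
    (h : InexactOrbit P q A C ρ σ α x z y p xh e₁ e₂) (hρ : 0 < ρ) (hσ : 0 < σ) (hα : 0 < α)
    (hx : Tendsto (fun k => x (k + 1) - x k) atTop (𝓝 dx))
    (hv : Tendsto (fun k => (z (k + 1) + ρ⁻¹ • y (k + 1)) - (z k + ρ⁻¹ • y k)) atTop (𝓝 dv)) :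
    Tendsto (fun k => P *ᵥ x k + q + Aᵀ *ᵥ y k) atTop
      (𝓝 (-(α⁻¹ • (P *ᵥ dx + σ • dx + ρ • (Aᵀ *ᵥ dv))))) := by
  obtain ⟨h1, h2⟩ := h.tendsto_linear hρ hσ hα hx hv
  have h3 := (((tendsto_mulVec P h1).add (h1.const_smul σ)).add
    ((tendsto_mulVec Aᵀ h2).const_smul ρ)).neg
  have e : P *ᵥ α⁻¹ • dx + σ • α⁻¹ • dx + ρ • (Aᵀ *ᵥ α⁻¹ • dv) =
      α⁻¹ • (P *ᵥ dx + σ • dx + ρ • (Aᵀ *ᵥ dv)) := by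
    rw [Matrix.mulVec_smul, Matrix.mulVec_smul]
    module
  rw [e] at h3
  refine h3.congr fun k => ?_
  have h4 := h.prox k
  rw [IsProxPoint, show A *ᵥ xh k - (z k - ρ⁻¹ • y k) = (A *ᵥ xh k - z k) + ρ⁻¹ • y k by abel,
    Matrix.mulVec_add, Matrix.mulVec_smul, smul_add, smul_smul, mul_inv_cancel₀ hρ.ne',
    one_smul] at h4
  rw [Matrix.mulVec_sub P]
  linear_combination (exp := 1) -h4

/-- The increments of `z` are asymptotically those of `A x`, since `A x - z` converges. -/
theorem InexactOrbit.tendsto_increment_z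
    (h : InexactOrbit P q A C ρ σ α x z y p xh e₁ e₂) (hρ : 0 < ρ) (hσ : 0 < σ) (hα : 0 < α)
    (hx : Tendsto (fun k => x (k + 1) - x k) atTop (𝓝 dx))
    (hv : Tendsto (fun k => (z (k + 1) + ρ⁻¹ • y (k + 1)) - (z k + ρ⁻¹ • y k)) atTop (𝓝 dv)) :
    Tendsto (fun k => z (k + 1) - z k) atTop (𝓝 (A *ᵥ dx)) := by
  have h1 := h.tendsto_primal_residual hρ hσ hα hx hv
  have h2 := (tendsto_mulVec A hx).sub ((h1.comp (tendsto_add_atTop_nat 1)).sub h1)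
  rw [sub_self, sub_zero] at h2
  refine h2.congr fun k => ?_
  simp only [Function.comp, Matrix.mulVec_sub]
  abel

theorem InexactOrbit.tendsto_increment_y
    (h : InexactOrbit P q A C ρ σ α x z y p xh e₁ e₂) (hρ : 0 < ρ) (hσ : 0 < σ) (hα : 0 < α)
    (hx : Tendsto (fun k => x (k + 1) - x k) atTop (𝓝 dx))
    (hv : Tendsto (fun k => (z (k + 1) + ρ⁻¹ • y (k + 1)) - (z k + ρ⁻¹ • y k)) atTop (𝓝 dv)) :
    Tendsto (fun k => y (k + 1) - y k) atTop (𝓝 (ρ • (dv - A *ᵥ dx))) := by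
  refine ((hv.sub (h.tendsto_increment_z hρ hσ hα hx hv)).const_smul ρ).congr fun k => ?_
  rw [show z (k + 1) + ρ⁻¹ • y (k + 1) - (z k + ρ⁻¹ • y k) - (z (k + 1) - z k) =
    ρ⁻¹ • (y (k + 1) - y k) by module, smul_smul, mul_inv_cancel₀ hρ.ne', one_smul]

end Orbit

/-! ### Certificates -/

section Certificates

variable {n m : ℕ} {P : Matrix (Fin n) (Fin n) ℝ} {q : Fin n → ℝ} {A : Matrix (Fin m) (Fin n) ℝ}
  {C : Set (Fin m → ℝ)} {ρ σ α : ℝ}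

theorem IsKKT.isSolution (hP : P.PosSemidef) {x : Fin n → ℝ} {z y : Fin m → ℝ}
    (h : IsKKT P q A C x z y) : IsSolution P q A C x z := by
  obtain ⟨hf, hstat, hn⟩ := h
  refine ⟨hf, fun x' z' hf' => ?_⟩
  have h1 := hn z' hf'.2
  rw [← hf.1, ← hf'.1, ← Matrix.mulVec_sub, ← transpose_mulVec_dotProduct] at h1
  have h2 := congrArg (fun u => u ⬝ᵥ (x' - x)) hstat
  simp only [add_dotProduct, zero_dotProduct] at h2
  have h3 := hP.dotProduct_mulVec_nonneg (x' - x)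
  have hsymm : x ⬝ᵥ (P *ᵥ x') = x' ⬝ᵥ (P *ᵥ x) := by
    have hT : Pᵀ = P := (Matrix.isHermitian_iff_isSymm.1 hP.1).eq
    rw [← transpose_mulVec_dotProduct, hT, dotProduct_comm]
  have hcomm : (P *ᵥ x) ⬝ᵥ x = x ⬝ᵥ (P *ᵥ x) := dotProduct_comm _ _
  have hcomm' : (P *ᵥ x) ⬝ᵥ x' = x' ⬝ᵥ (P *ᵥ x) := dotProduct_comm _ _
  simp only [star_trivial, Matrix.mulVec_sub, sub_dotProduct, dotProduct_sub] at h1 h2 h3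
  simp only [objective]
  linarith

theorem IsPrimalInfeasCert.primalInfeasible {dy : Fin m → ℝ} (h : IsPrimalInfeasCert A C dy) :
    PrimalInfeasible A C := by
  rintro ⟨x, z, rfl, hz⟩
  have h1 : ((dy ⬝ᵥ (A *ᵥ x) : ℝ) : EReal) ≤ supportFn C dy :=
    le_iSup₂ (f := fun z (_ : z ∈ C) => ((dy ⬝ᵥ z : ℝ) : EReal)) _ hz
  rw [← transpose_mulVec_dotProduct, h.1, zero_dotProduct] at h1
  exact absurd h.2 (not_lt.2 h1)

/-- Linear functionals bounded above on `C` are nonpositive on the recession cone. -/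
theorem dotProduct_nonpos_of_mem_recessionCone (hCne : C.Nonempty) {y d : Fin m → ℝ}
    (hd : d ∈ recessionCone C) {B : ℝ} (hB : ∀ w ∈ C, y ⬝ᵥ w ≤ B) : y ⬝ᵥ d ≤ 0 := by
  obtain ⟨w, hw⟩ := hCne
  by_contra! hpos
  have h1 := hB w hw
  have h2 := hB _ (hd w hw ((B - y ⬝ᵥ w + 1) / (y ⬝ᵥ d)) (div_nonneg (by linarith) hpos.le))
  rw [dotProduct_add, dotProduct_smul, smul_eq_mul, div_mul_cancel₀ _ hpos.ne'] at h2
  linarith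

theorem IsDualInfeasCert.dualInfeasible (hP : P.PosSemidef) (hCne : C.Nonempty)
    {dx : Fin n → ℝ} (h : IsDualInfeasCert P q A C dx) : DualInfeasible P q A C := by
  rintro ⟨x, y, heq, hS⟩
  obtain ⟨hPd, hrec, hq⟩ := h
  obtain ⟨B, hSB, -⟩ := EReal.lt_iff_exists_real_btwn.1 hS
  have h1 : y ⬝ᵥ (A *ᵥ dx) ≤ 0 := dotProduct_nonpos_of_mem_recessionCone hCne hrec (B := B)
    fun w hw => EReal.coe_le_coe_iff.1
      ((le_iSup₂ (f := fun z (_ : z ∈ C) => ((y ⬝ᵥ z : ℝ) : EReal)) w hw).trans hSB.le)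
  have hT : Pᵀ = P := (Matrix.isHermitian_iff_isSymm.1 hP.1).eq
  have h2 := congrArg (fun u => u ⬝ᵥ dx) heq
  have h3 : (P *ᵥ x) ⬝ᵥ dx = 0 := by
    rw [← hT, transpose_mulVec_dotProduct, hPd, dotProduct_zero]
  simp only [add_dotProduct, neg_dotProduct, transpose_mulVec_dotProduct, h3] at h2
  linarith

/-- Points of a closed convex set that grow linearly do so in a recession direction. -/
theorem mem_recessionCone_of_tendsto (hCcl : IsClosed C) (hCcv : Convex ℝ C)
    {p : ℕ → Fin m → ℝ} {d : Fin m → ℝ} (hp : ∀ k, p k ∈ C)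
    (hd : Tendsto (fun k : ℕ => (k : ℝ)⁻¹ • p k) atTop (𝓝 d)) : d ∈ recessionCone C := by
  intro w hw t ht
  have hc : Tendsto (fun k : ℕ => t * (k : ℝ)⁻¹) atTop (𝓝 0) := by
    simpa using (tendsto_inv_atTop_nhds_zero_nat (𝕜 := ℝ)).const_mul t
  have hlim : Tendsto (fun k : ℕ => w + (t * (k : ℝ)⁻¹) • (p k - w)) atTop
      (𝓝 (w + (t • d - (0 : ℝ) • w))) := by
    refine tendsto_const_nhds.add (((hd.const_smul t).sub (hc.smul_const w)).congr fun k => ?_)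
    module
  rw [zero_smul, sub_zero] at hlim
  refine hCcl.mem_of_tendsto hlim ?_
  filter_upwards [hc.eventually_le_const one_pos] with k hk
  exact hCcv.add_smul_sub_mem hw (hp k) ⟨by positivity, hk⟩

variable {x xh e₁ : ℕ → Fin n → ℝ} {z y p e₂ : ℕ → Fin m → ℝ} {dx : Fin n → ℝ} {dv dy : Fin m → ℝ}

/-- The limiting increments are certificates. The limits `r` and `t` of the residuals
`-(P x + q + Aᵀ y)` and `A x - z` satisfy, for every `w ∈ C`,
`qᵀ dx + ⟨w, dy⟩ + ⟨t, dy⟩ + ⟨r, dx⟩ ≤ 0`, which is the dual residual paired with `x k / k` in the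
limit. Pairing the dual residual with `dx` and the primal one with `dy` gives the complementary
inequalities that separate the two parts of this sum. -/
theorem InexactOrbit.certificates (h : InexactOrbit P q A C ρ σ α x z y p xh e₁ e₂)
    (hP : P.PosSemidef) (hCcl : IsClosed C) (hCcv : Convex ℝ C) (hρ : 0 < ρ) (hσ : 0 < σ)
    (hα : 0 < α) (hx : Tendsto (fun k => x (k + 1) - x k) atTop (𝓝 dx))
    (hv : Tendsto (fun k => (z (k + 1) + ρ⁻¹ • y (k + 1)) - (z k + ρ⁻¹ • y k)) atTop (𝓝 dv))
    (hdy : dy = ρ • (dv - A *ᵥ dx)) :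
    (dy ≠ 0 → IsPrimalInfeasCert A C dy) ∧ (dx ≠ 0 → IsDualInfeasCert P q A C dx) := by
  have hprim := h.tendsto_primal_residual hρ hσ hα hx hv
  have hdual := h.tendsto_dual_residual hρ hσ hα hx hv
  have hzinc := h.tendsto_increment_z hρ hσ hα hx hv
  have hyinc := h.tendsto_increment_y hρ hσ hα hx hv
  rw [← hdy] at hyinc
  have hzp := h.tendsto_proj_sub hρ
  have hc := tendsto_inv_atTop_nhds_zero_nat (𝕜 := ℝ)
  have hc0 : ∀ k : ℕ, 0 ≤ (k : ℝ)⁻¹ := fun k => by positivity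
  have hpC : ∀ k, p k ∈ C := fun k => (h.proj k).1
  have hcx := tendsto_inv_smul hx
  have hcy := tendsto_inv_smul hyinc
  have hcp : Tendsto (fun k : ℕ => (k : ℝ)⁻¹ • p k) atTop (𝓝 (A *ᵥ dx)) := by
    have h1 := (tendsto_inv_smul hzinc).sub (hc.smul hzp)
    rw [smul_zero, sub_zero] at h1
    refine h1.congr fun k => ?_
    module
  -- `η` is the exact normal vector at `p`, asymptotically equal to `y / ρ`
  set η : ℕ → Fin m → ℝ := fun k => z k + ρ⁻¹ • y k - p k with hη
  have hηn : ∀ k, ∀ w ∈ C, η k ⬝ᵥ w ≤ η k ⬝ᵥ p k := by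
    intro k w hw
    have h1 := (h.proj k).2 w hw
    rw [dotProduct_sub] at h1
    linarith
  have hyη : ∀ k, y k = ρ • η k + ρ • (p k - z k) := by
    intro k
    rw [← smul_add, hη, show z k + ρ⁻¹ • y k - p k + (p k - z k) = ρ⁻¹ • y k by abel, smul_smul,
      mul_inv_cancel₀ hρ.ne', one_smul]
  have hpz : Tendsto (fun k => p k - z k) atTop (𝓝 0) := by
    simpa using hzp.neg
  have hcη : Tendsto (fun k : ℕ => (k : ℝ)⁻¹ • η k) atTop (𝓝 (ρ⁻¹ • dy)) := by
    have h1 := (hcy.const_smul ρ⁻¹).add (hc.smul hzp)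
    rw [smul_zero, add_zero] at h1
    refine h1.congr fun k => ?_
    simp only [hη]
    module
  have hrec : A *ᵥ dx ∈ recessionCone C := mem_recessionCone_of_tendsto hCcl hCcv hpC hcp
  have hηrec : ∀ k, η k ⬝ᵥ (A *ᵥ dx) ≤ 0 := fun k =>
    dotProduct_nonpos_of_mem_recessionCone ⟨_, hpC 0⟩ hrec (hηn k)
  -- `dy` is orthogonal to `A dx`, the increment of `z`
  have horth : dy ⬝ᵥ (A *ᵥ dx) = 0 := by
    have hle : (ρ⁻¹ • dy) ⬝ᵥ (A *ᵥ dx) ≤ 0 :=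
      le_of_tendsto' (tendsto_dotProduct hcη tendsto_const_nhds) fun k => by
        rw [smul_dotProduct]
        exact mul_nonpos_of_nonneg_of_nonpos (hc0 k) (hηrec k)
    have hge : (ρ⁻¹ • dy) ⬝ᵥ ((0 : ℝ) • p 0) ≤ (ρ⁻¹ • dy) ⬝ᵥ (A *ᵥ dx) :=
      le_of_tendsto_of_tendsto' (tendsto_dotProduct hcη (hc.smul_const (p 0)))
        (tendsto_dotProduct hcη hcp) fun k => by
        simp only [smul_dotProduct, dotProduct_smul, smul_eq_mul]
        exact mul_le_mul_of_nonneg_left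
          (mul_le_mul_of_nonneg_left (hηn k _ (hpC 0)) (hc0 k)) (hc0 k)
    rw [zero_smul, dotProduct_zero] at hge
    have h1 := le_antisymm hle hge
    rw [smul_dotProduct, smul_eq_mul] at h1
    exact (mul_eq_zero.1 h1).resolve_left (by positivity)
  have hstat : P *ᵥ dx + Aᵀ *ᵥ dy = 0 := by
    refine tendsto_nhds_unique ((tendsto_mulVec P hx).add (tendsto_mulVec Aᵀ hyinc)) ?_
    have h1 := (hdual.comp (tendsto_add_atTop_nat 1)).sub hdual
    rw [sub_self] at h1
    refine h1.congr fun k => ?_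
    simp only [Function.comp, Matrix.mulVec_sub]
    abel
  have hPdx : P *ᵥ dx = 0 := by
    refine (hP.dotProduct_mulVec_zero_iff dx).1 ?_
    have h1 := congrArg (fun u => u ⬝ᵥ dx) hstat
    simp only [add_dotProduct, zero_dotProduct, transpose_mulVec_dotProduct, horth] at h1
    rw [star_trivial, dotProduct_comm]
    linarith
  have hAdy : Aᵀ *ᵥ dy = 0 := by rwa [hPdx, zero_add] at hstat
  have hdv : dv = A *ᵥ dx + ρ⁻¹ • dy := by
    rw [hdy, smul_smul, inv_mul_cancel₀ hρ.ne', one_smul]; abel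
  have ht : α⁻¹ • (dv - A *ᵥ dx) = (α⁻¹ * ρ⁻¹) • dy := by rw [hdv]; module
  rw [ht] at hprim
  set r : Fin n → ℝ := α⁻¹ • (P *ᵥ dx + σ • dx + ρ • (Aᵀ *ᵥ dv)) with hr
  have hrdx : r ⬝ᵥ dx = α⁻¹ * (σ * (dx ⬝ᵥ dx) + ρ * ((A *ᵥ dx) ⬝ᵥ (A *ᵥ dx))) := by
    rw [hr, hPdx, zero_add, smul_dotProduct, add_dotProduct, smul_dotProduct, smul_dotProduct,
      transpose_mulVec_dotProduct, hdv, add_dotProduct, smul_dotProduct, horth]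
    simp
  have hmain : ∀ w ∈ C,
      q ⬝ᵥ dx + dy ⬝ᵥ w + α⁻¹ * ρ⁻¹ * (dy ⬝ᵥ dy) + r ⬝ᵥ dx ≤ 0 := by
    intro w hw
    have hlim := ((((tendsto_dotProduct (tendsto_const_nhds (x := q)) hcx).add
      (tendsto_dotProduct hcy hprim)).add (tendsto_dotProduct hcy hzp)).add
      ((tendsto_dotProduct hcη (tendsto_const_nhds (x := w))).const_mul ρ)).add
      ((tendsto_dotProduct hpz hcp).const_mul ρ)
    have hle := le_of_tendsto_of_tendsto' hlim (tendsto_dotProduct hdual hcx) fun k => by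
      have h1 : (P *ᵥ x k) ⬝ᵥ x k + q ⬝ᵥ x k + y k ⬝ᵥ (A *ᵥ x k) =
          (P *ᵥ x k + q + Aᵀ *ᵥ y k) ⬝ᵥ x k := by
        rw [add_dotProduct, add_dotProduct, transpose_mulVec_dotProduct]
      have h2 := hP.dotProduct_mulVec_nonneg (x k)
      rw [star_trivial, dotProduct_comm] at h2
      have h3 : y k ⬝ᵥ (A *ᵥ x k) =
          y k ⬝ᵥ (A *ᵥ x k - z k) + y k ⬝ᵥ (z k - p k) + y k ⬝ᵥ p k := by
        rw [← dotProduct_add, ← dotProduct_add]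
        congr 1; abel
      have h4 : y k ⬝ᵥ p k = ρ * (η k ⬝ᵥ p k) + ρ * ((p k - z k) ⬝ᵥ p k) := by
        conv_lhs => rw [hyη k]
        rw [add_dotProduct, smul_dotProduct, smul_dotProduct, smul_eq_mul, smul_eq_mul]
      have h5 := mul_le_mul_of_nonneg_left (hηn k w hw) hρ.le
      have h6 := mul_le_mul_of_nonneg_left (show q ⬝ᵥ x k + y k ⬝ᵥ (A *ᵥ x k - z k) +
        y k ⬝ᵥ (z k - p k) + ρ * (η k ⬝ᵥ w) + ρ * ((p k - z k) ⬝ᵥ p k) ≤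
        (P *ᵥ x k + q + Aᵀ *ᵥ y k) ⬝ᵥ x k by linarith) (hc0 k)
      simp only [smul_dotProduct, dotProduct_smul, smul_eq_mul]
      linarith
    simp only [dotProduct_zero, zero_dotProduct, mul_zero, add_zero, dotProduct_smul,
      smul_dotProduct, neg_dotProduct, smul_eq_mul, mul_inv_cancel_left₀ hρ.ne'] at hle
    linarith
  have hlow : -(r ⬝ᵥ dx) ≤ q ⬝ᵥ dx := by
    have hlim := ((tendsto_dotProduct hpz (tendsto_const_nhds (x := A *ᵥ dx))).const_mul
      ρ).const_add (q ⬝ᵥ dx)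
    have hle := le_of_tendsto_of_tendsto'
      (tendsto_dotProduct hdual (tendsto_const_nhds (x := dx))) hlim fun k => by
      have h1 : (P *ᵥ x k) ⬝ᵥ dx = 0 := by
        have hT : Pᵀ = P := (Matrix.isHermitian_iff_isSymm.1 hP.1).eq
        rw [← hT, transpose_mulVec_dotProduct, hPdx, dotProduct_zero]
      rw [add_dotProduct, add_dotProduct, h1, transpose_mulVec_dotProduct]
      conv_lhs => rw [hyη k]
      rw [add_dotProduct, smul_dotProduct, smul_dotProduct, smul_eq_mul, smul_eq_mul]
      have := mul_nonpos_of_nonneg_of_nonpos hρ.le (hηrec k)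
      linarith
    simpa using hle
  have hpdy : Tendsto (fun k => dy ⬝ᵥ p k) atTop (𝓝 (-(α⁻¹ * ρ⁻¹ * (dy ⬝ᵥ dy)))) := by
    have hlim := ((tendsto_dotProduct (tendsto_const_nhds (x := dy)) hprim).add
      (tendsto_dotProduct (tendsto_const_nhds (x := dy)) hzp)).neg
    rw [dotProduct_zero, add_zero, dotProduct_smul, smul_eq_mul] at hlim
    refine hlim.congr fun k => ?_
    rw [← dotProduct_add, sub_add_sub_cancel, dotProduct_sub, ← transpose_mulVec_dotProduct,
      hAdy, zero_dotProduct, zero_sub, neg_neg]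
  refine ⟨fun hne => ⟨hAdy, ?_⟩, fun hne => ⟨hPdx, hrec, ?_⟩⟩
  · have hneg : -(α⁻¹ * ρ⁻¹ * (dy ⬝ᵥ dy)) < 0 :=
      neg_lt_zero.2 (mul_pos (by positivity) (dotProduct_self_pos hne))
    refine lt_of_le_of_lt (iSup₂_le fun w hw => ?_) (EReal.coe_lt_coe_iff.2 hneg)
    exact EReal.coe_le_coe_iff.2 (by linarith [hmain w hw])
  · have h1 := le_of_tendsto' hpdy (b := -(q ⬝ᵥ dx + α⁻¹ * ρ⁻¹ * (dy ⬝ᵥ dy) + r ⬝ᵥ dx))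
      fun k => by linarith [hmain _ (hpC k)]
    have h2 : 0 < r ⬝ᵥ dx := by
      rw [hrdx]
      have := mul_pos hσ (dotProduct_self_pos hne)
      have := mul_nonneg hρ.le (dotProduct_self_nonneg' (A *ᵥ dx))
      positivity
    linarith

/-- A convergent inexact orbit converges to a KKT point, because both residuals vanish in the
limit. -/
theorem InexactOrbit.exists_isKKT_tendsto (h : InexactOrbit P q A C ρ σ α x z y p xh e₁ e₂)
    (hCcl : IsClosed C) (hρ : 0 < ρ) (hσ : 0 < σ) (hα : 0 < α) {xs : Fin n → ℝ}
    {vs : Fin m → ℝ} (hx : Tendsto x atTop (𝓝 xs))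
    (hv : Tendsto (fun k => z k + ρ⁻¹ • y k) atTop (𝓝 vs)) :
    ∃ zs ys, IsKKT P q A C xs zs ys ∧ Tendsto z atTop (𝓝 zs) ∧ Tendsto y atTop (𝓝 ys) := by
  have hx0 : Tendsto (fun k => x (k + 1) - x k) atTop (𝓝 0) := by
    simpa using (hx.comp (tendsto_add_atTop_nat 1)).sub hx
  have hv0 : Tendsto (fun k => (z (k + 1) + ρ⁻¹ • y (k + 1)) - (z k + ρ⁻¹ • y k)) atTop
      (𝓝 0) := by
    rw [← sub_self vs]
    exact (hv.comp (tendsto_add_atTop_nat 1)).sub hv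
  have hprim := h.tendsto_primal_residual hρ hσ hα hx0 hv0
  have hdual := h.tendsto_dual_residual hρ hσ hα hx0 hv0
  simp only [Matrix.mulVec_zero, sub_zero, smul_zero, add_zero, neg_zero] at hprim hdual
  have hz : Tendsto z atTop (𝓝 (A *ᵥ xs)) := by
    simpa using (tendsto_mulVec A hx).sub hprim
  have hy : Tendsto y atTop (𝓝 (ρ • (vs - A *ᵥ xs))) := by
    refine ((hv.sub hz).const_smul ρ).congr fun k => ?_
    rw [add_sub_cancel_left, smul_smul, mul_inv_cancel₀ hρ.ne', one_smul]
  have hp : Tendsto p atTop (𝓝 (A *ᵥ xs)) := by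
    simpa using hz.sub (h.tendsto_proj_sub hρ)
  refine ⟨_, _, ⟨⟨rfl, hCcl.mem_of_tendsto hp (Eventually.of_forall fun k => (h.proj k).1)⟩,
    ?_, fun w hw => ?_⟩, hz, hy⟩
  · exact tendsto_nhds_unique
      (((tendsto_mulVec P hx).add tendsto_const_nhds).add (tendsto_mulVec Aᵀ hy)) hdual
  · rw [smul_dotProduct]
    exact mul_nonpos_of_nonneg_of_nonpos hρ.le (le_of_tendsto'
      (tendsto_dotProduct (hv.sub hp) (tendsto_const_nhds.sub hp)) fun k => (h.proj k).2 w hw)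

end Certificates

end ApproxADMM

theorem mainTheorem1 {n m : ℕ}
    (P : Matrix (Fin n) (Fin n) ℝ) (hP : P.PosSemidef) (q : Fin n → ℝ)
    (A : Matrix (Fin m) (Fin n) ℝ)
    (C : Set (Fin m → ℝ)) (hCne : C.Nonempty) (hCcl : IsClosed C) (hCcv : Convex ℝ C)
    (hC : ApproxADMM.IsCompactProdCone C)
    (ρ σ α : ℝ) (hρ : 0 < ρ) (hσ : 0 < σ) (hα : α ∈ Set.Ioo (0 : ℝ) 2)
    (μ ν : ℕ → ℝ) (hμ : Summable μ) (hν : Summable ν)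
    (x : ℕ → Fin n → ℝ) (z y : ℕ → Fin m → ℝ)
    (hstep : ∀ k : ℕ, ApproxADMM.Step P q A C ρ σ α (μ k) (ν k)
      (x k) (z k) (y k) (x (k + 1)) (z (k + 1)) (y (k + 1))) :
    ((∃ xs zs ys, ApproxADMM.IsKKT P q A C xs zs ys) →
      ∃ xs zs ys, ApproxADMM.IsKKT P q A C xs zs ys ∧ ApproxADMM.IsSolution P q A C xs zs ∧
        Filter.Tendsto x Filter.atTop (𝓝 xs) ∧ Filter.Tendsto z Filter.atTop (𝓝 zs) ∧
        Filter.Tendsto y Filter.atTop (𝓝 ys)) ∧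
    ∃ (dx : Fin n → ℝ) (dy : Fin m → ℝ),
      Filter.Tendsto (fun k => x (k + 1) - x k) Filter.atTop (𝓝 dx) ∧
      Filter.Tendsto (fun k => y (k + 1) - y k) Filter.atTop (𝓝 dy) ∧
      (dy ≠ 0 → ApproxADMM.PrimalInfeasible A C ∧ ApproxADMM.IsPrimalInfeasCert A C dy) ∧
      (dx ≠ 0 → ApproxADMM.DualInfeasible P q A C ∧ ApproxADMM.IsDualInfeasCert P q A C dx) ∧
      (dx ≠ 0 ∧ dy ≠ 0 →
        (ApproxADMM.PrimalInfeasible A C ∧ ApproxADMM.DualInfeasible P q A C) ∧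
        ApproxADMM.IsPrimalInfeasCert A C dy ∧ ApproxADMM.IsDualInfeasCert P q A C dx) := by
  obtain ⟨p, xh, e₁, e₂, h⟩ :=
    ApproxADMM.exists_inexactOrbit hCcv hρ hσ hα.1 hμ hν hstep
  refine ⟨?_, ?_⟩
  · rintro ⟨xk, zk, yk, hk⟩
    obtain ⟨xs, vs, hx, hv⟩ := h.exists_tendsto hP hCcl hCcv hρ hσ hα hk
    obtain ⟨zs, ys, hs, hz, hy⟩ := h.exists_isKKT_tendsto hCcl hρ hσ hα.1 hx hv
    exact ⟨xs, zs, ys, hs, hs.isSolution hP, (Filter.tendsto_add_atTop_iff_nat 1).1 hx,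
      (Filter.tendsto_add_atTop_iff_nat 1).1 hz, (Filter.tendsto_add_atTop_iff_nat 1).1 hy⟩
  · obtain ⟨dx, dv, hx, hv⟩ := h.exists_tendsto_increments hP hCne hCcl hCcv hρ hσ hα
    obtain ⟨hpri, hdua⟩ := h.certificates hP hCcl hCcv hρ hσ hα.1 hx hv rfl
    have hy := h.tendsto_increment_y hρ hσ hα.1 hx hv
    have hpri' := fun hne => And.intro (hpri hne).primalInfeasible (hpri hne)
    have hdua' := fun hne => And.intro ((hdua hne).dualInfeasible hP hCne) (hdua hne)
    exact ⟨dx, _, (Filter.tendsto_add_atTop_iff_nat (f := fun k => x (k + 1) - x k) 1).1 hx,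
      (Filter.tendsto_add_atTop_iff_nat (f := fun k => y (k + 1) - y k) 1).1 hy, hpri', hdua',
      fun hne => ⟨⟨(hpri' hne.2).1, (hdua' hne.1).1⟩, (hpri' hne.2).2, (hdua' hne.1).2⟩⟩
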